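/- Notation. Let $\mathbb D=\{z\in\mathbb C:|z|<1\}$, $\mathbb T=\partial\mathbb D$, $RH=\{w\in\mathbb C:\operatorname{Re} w>0\}$. For a Borel probability measure $\mu$ on $\mathbb T$ put $$\psi_\mu(z)=\int_{\mathbb T}\frac{xz}{1-xz}\,\mu(dx),\qquad \eta_\mu(z)=\frac{\psi_\mu(z)}{1+\psi_\mu(z)}\qquad(z\in\mathbb D).$$ Let $\mathcal P_\times(\mathbb T)$ be the set of those $\mu$ with $\eta_\mu'(0)\neq0$; for such $\mu$ let $\eta_\mu^{-1}$ be the holomorphic inverse of $\eta_\mu$ near $0$ with $\eta_\mu^{-1}(0)=0$, and let $\Sigma_\mu(z)=\eta_\mu^{-1}(z)/z$ (with the removable singularity at $0$ filled in). For $\mu,\nu\in\mathcal P_\times(\mathbb T)$ the multiplicative free convolution $\mu\boxtimes\nu\in\mathcal P_\times(\mathbb T)$ is characterized by $\Sigma_{\mu\boxtimes\nu}=\Sigma_\mu\Sigma_\nu$ in a neighbourhood of $0$. A $\boxtimes$-convolution semigroup is a family $(\nu_t)_{t\ge0}\subset\mathcal P_\times(\mathbb T)$ with $\nu_0=\delta_1$,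 $\nu_{t+s}=\nu_t\boxtimes\nu_s$ for all $s,t\ge0$, and $t\mapsto\nu_t$ weakly continuous. Theorem. Let $S:RH\to RH$ be holomorphic and let $\alpha$ be a Borel probability measure on $\mathbb T$. Then there is exactly one family $(M_t)_{t\ge0}$ of holomorphic maps $M_t:\mathbb D\to RH$ such that $$\frac{\partial}{\partial t}M_t(z)=-z\,S(M_t(z))\,\frac{\partial}{\partial z}M_t(z)\quad(t\ge0,\ z\in\mathbb D),\qquad M_0(z)=\int_{\mathbb T}\frac{x+z}{x-z}\,\alpha(dx)\quad(z\in\mathbb D),$$ where the time derivative at $t=0$ is one-sided. Moreover, there is a $\boxtimes$-convolution semigroup $(\nu_t)_{t\ge0}$ such that, for all $t\ge0$, $\eta_{\nu_t}$ maps $\mathbb D$ into $\mathbb D$ and $M_t=M_0\circ\eta_{\nu_t}$ on $\mathbb D$. -/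

import Mathlib

open MeasureTheory Filter Topology

noncomputable section

namespace BurgersLoewner

/-- The Borel `σ`-algebra of the unit circle. -/
instance instMeasurableSpaceCircle : MeasurableSpace Circle := borel Circle

instance instBorelSpaceCircle : BorelSpace Circle := ⟨rfl⟩

/-- The open unit disc. -/
def disc : Set ℂ := Metric.ball (0 : ℂ) 1

/-- The open right half-plane. -/
def RH : Set ℂ := {w : ℂ | 0 < w.re}

/-- The Herglotz transform of a probability measure on the unit circle. -/
def herglotz (α : ProbabilityMeasure Circle) (z : ℂ) : ℂ :=
  ∫ x : Circle, ((x : ℂ) + z) / ((x : ℂ) - z) ∂(α : Measure Circle)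

/-- The moment generating function `ψ_μ`. -/
def psi (μ : ProbabilityMeasure Circle) (z : ℂ) : ℂ :=
  ∫ x : Circle, ((x : ℂ) * z) / (1 - (x : ℂ) * z) ∂(μ : Measure Circle)

/-- The `η`-transform `η_μ = ψ_μ / (1 + ψ_μ)`. -/
def eta (μ : ProbabilityMeasure Circle) (z : ℂ) : ℂ :=
  psi μ z / (1 + psi μ z)

/-- The class of probability measures on the circle with `η_μ'(0) ≠ 0`. -/
def PTimes : Set (ProbabilityMeasure Circle) :=
  {μ | deriv (eta μ) 0 ≠ 0}

/-- `g` is a holomorphic inverse of `f` in a neighbourhood of `0`, with `g 0 = 0`.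
For `f` holomorphic near `0` with `f 0 = 0` and `f'(0) ≠ 0` such a `g` exists, and any two of
them agree near `0`. -/
def IsLocalInverse (f g : ℂ → ℂ) : Prop :=
  AnalyticAt ℂ g 0 ∧ g 0 = 0 ∧ ∀ᶠ z in 𝓝 (0 : ℂ), f (g z) = z ∧ g (f z) = z

open Classical in
/-- The local inverse `η_μ⁻¹` at `0`; only its germ at `0` is meaningful, and only for `μ` in
`PTimes`. -/
def etaInv (μ : ProbabilityMeasure Circle) : ℂ → ℂ :=
  if h : ∃ g, IsLocalInverse (eta μ) g then Classical.choose h else 0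

/-- The `Σ`-transform `Σ_μ(z) = η_μ⁻¹(z) / z`, with the removable singularity at `0` filled in
by the value `(η_μ⁻¹)'(0)`. -/
def sigmaTransform (μ : ProbabilityMeasure Circle) : ℂ → ℂ :=
  dslope (etaInv μ) 0

/-- `ρ` is the multiplicative free convolution of `μ` and `ν`: all three lie in `PTimes`, and
`Σ_ρ = Σ_μ Σ_ν` in a neighbourhood of `0`. (This determines `ρ`.) -/
def IsFreeMulConv (μ ν ρ : ProbabilityMeasure Circle) : Prop :=
  μ ∈ PTimes ∧ ν ∈ PTimes ∧ ρ ∈ PTimes ∧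
    ∀ᶠ z in 𝓝 (0 : ℂ), sigmaTransform ρ z = sigmaTransform μ z * sigmaTransform ν z

/-- A weakly continuous semigroup, indexed by `t ≥ 0`, for the multiplicative free convolution,
starting at the Dirac measure at `1`. The topology on `ProbabilityMeasure Circle` is that of weak
convergence. -/
structure IsFreeMulSemigroup (ν : NNReal → ProbabilityMeasure Circle) : Prop where
  zero : (ν 0 : Measure Circle) = Measure.dirac 1
  add : ∀ s t : NNReal, IsFreeMulConv (ν t) (ν s) (ν (t + s))
  continuous : Continuous ν

/-- `(M t)`, `t ≥ 0`, is a family of holomorphic maps from the disc to the right half-plane which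
solves `∂M/∂t = - z S(M) ∂M/∂z` for all `t ≥ 0` and all `z` in the disc (with the one-sided time
derivative at `t = 0`), with the Herglotz transform of `α` as initial value. The values of `M t z`
for `t < 0` or for `z` outside the disc are irrelevant. -/
structure IsSolution (S : ℂ → ℂ) (α : ProbabilityMeasure Circle) (M : ℝ → ℂ → ℂ) : Prop where
  holo : ∀ t, 0 ≤ t → DifferentiableOn ℂ (M t) disc
  mapsTo : ∀ t, 0 ≤ t → Set.MapsTo (M t) disc RH
  pde : ∀ t, 0 ≤ t → ∀ z ∈ disc,
    HasDerivWithinAt (fun s : ℝ => M s z) (-z * S (M t z) * deriv (M t) z) (Set.Ici 0) t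
  init : ∀ z ∈ disc, M 0 z = herglotz α z

end BurgersLoewner

end

namespace BurgersLoewner

open Metric Set
open scoped ComplexConjugate

/-! Put `H = herglotz α` and `u = S ∘ H`, so that `Re u > 0` on the disc. The equation is
quasilinear: a solution should be constant along the curves `t ↦ w exp(t u(w))`, which solve `c' = c
S(h)` with `h = H w` fixed.

A point `w` is carried to `z` at time `t` exactly when it is a fixed point of `v ↦ z exp(-t u(v))`,
which maps the disc into the closed ball of radius `‖z‖ < 1`. The Schwarz lemma makes such a point
unique and nondegenerate (`fixedPoint_of_mapsTo_closedBall`); a connectedness argument produces it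
(`exists_charMap_eq`). The inverse `flow u t` is a holomorphic self-map of the disc fixing `0`, and
`H ∘ flow u t` solves the equation.

By the Herglotz representation, each `flow u t` is an `η`-transform (`exists_psi_eq`). Its local
inverse is `w exp(t u(w))`, so its `Σ`-transform is `exp(t u)`, and the semigroup law is additivity
of the exponent. For uniqueness, a Gronwall argument shows that every solution is constant along
characteristics (`IsSolution.eq_along_characteristic`), and these cover the disc at each time. -/

/-! ### Möbius maps and the fixed point lemma. -/

theorem norm_sub_lt_norm_one_sub_conj_mul {a w : ℂ} (ha : ‖a‖ < 1) (hw : ‖w‖ < 1) :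
    ‖w - a‖ < ‖1 - conj a * w‖ := by
  have key : ‖1 - conj a * w‖ ^ 2 - ‖w - a‖ ^ 2 = (1 - ‖a‖ ^ 2) * (1 - ‖w‖ ^ 2) := by
    simp only [← Complex.normSq_eq_norm_sq, Complex.normSq_apply]
    simp
    ring
  have h1 : 0 < (1 - ‖a‖ ^ 2) * (1 - ‖w‖ ^ 2) := by
    apply mul_pos <;> nlinarith [norm_nonneg a, norm_nonneg w]
  exact lt_of_pow_lt_pow_left₀ 2 (norm_nonneg _) (by linarith)

theorem one_sub_conj_mul_ne_zero {a w : ℂ} (ha : ‖a‖ < 1) (hw : ‖w‖ < 1) :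
    1 - conj a * w ≠ 0 := by
  have := (norm_nonneg _).trans_lt (norm_sub_lt_norm_one_sub_conj_mul ha hw)
  exact norm_pos_iff.1 this

/-- The Möbius automorphism of the disc that sends `a` to `0`. -/
noncomputable def mobius (a w : ℂ) : ℂ := (w - a) / (1 - conj a * w)

theorem norm_mobius_lt_one {a w : ℂ} (ha : ‖a‖ < 1) (hw : ‖w‖ < 1) : ‖mobius a w‖ < 1 := by
  have h := norm_sub_lt_norm_one_sub_conj_mul ha hw
  rw [mobius, norm_div, div_lt_one ((norm_nonneg _).trans_lt h)]
  exact h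

theorem hasDerivAt_mobius {a w : ℂ} (ha : ‖a‖ < 1) (hw : ‖w‖ < 1) :
    HasDerivAt (mobius a) ((1 - conj a * a) / (1 - conj a * w) ^ 2) w := by
  have h := ((hasDerivAt_id w).sub_const a).div
    (((hasDerivAt_id w).const_mul (conj a)).const_sub 1) (one_sub_conj_mul_ne_zero ha hw)
  convert! h using 1
  simp only [id]
  ring

theorem mobius_neg_mobius {a w : ℂ} (ha : ‖a‖ < 1) (hw : ‖w‖ < 1) :
    mobius (-a) (mobius a w) = w := by
  have h1 := one_sub_conj_mul_ne_zero ha hw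
  have h2 := one_sub_conj_mul_ne_zero ha ha
  simp only [mobius, map_neg, sub_neg_eq_add, neg_mul]
  generalize conj a = c at *
  have h3 : 1 + c * ((w - a) / (1 - c * w)) = (1 - c * a) / (1 - c * w) := by
    rw [eq_div_iff h1, add_mul, mul_assoc, div_mul_cancel₀ _ h1]; ring
  have h4 : (w - a) / (1 - c * w) + a = w * (1 - c * a) / (1 - c * w) := by
    rw [eq_div_iff h1, add_mul, div_mul_cancel₀ _ h1]; ring
  rw [h3, h4, div_div_div_cancel_right₀ h1, mul_div_assoc, div_self h2, mul_one]

/-- A holomorphic self-map of the disc with relatively compact image has at most one fixed point,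
and this fixed point is attracting. -/
theorem fixedPoint_of_mapsTo_closedBall {f : ℂ → ℂ} {r : ℝ} {a : ℂ} (hr : r < 1)
    (hf : DifferentiableOn ℂ f disc) (hmaps : MapsTo f disc (closedBall 0 r))
    (ha : a ∈ disc) (hfa : f a = a) :
    ‖deriv f a‖ < 1 ∧ ∀ b ∈ disc, f b = b → b = a := by
  have ha' : ‖a‖ < 1 := by simpa [disc] using ha
  have hna' : ‖-a‖ < 1 := by simpa using ha'
  have hlt : ∀ w ∈ closedBall (0 : ℂ) r, ‖w‖ < 1 := fun w hw => by
    have := mem_closedBall_zero_iff.1 hw; linarith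
  -- Compactness of the ball of radius `r` makes the bound uniform; this strict gap is what improves
  -- the Schwarz lemma.
  obtain ⟨ρ, hρ1, hρ⟩ : ∃ ρ < 1, ∀ w ∈ closedBall (0 : ℂ) r, ‖mobius a w‖ ≤ ρ := by
    have hc : ContinuousOn (fun w => ‖mobius a w‖) (closedBall (0 : ℂ) r) := fun w hw =>
      (hasDerivAt_mobius ha' (hlt w hw)).continuousAt.norm.continuousWithinAt
    obtain ⟨w, hw, hmax⟩ := (isCompact_closedBall (0 : ℂ) r).exists_isMaxOn
      ⟨f a, hmaps ha⟩ hc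
    exact ⟨_, norm_mobius_lt_one ha' (hlt w hw), fun v hv => hmax hv⟩
  -- Conjugation moves the fixed point to `0`, where the Schwarz lemma gives `‖g w‖ ≤ ρ ‖w‖`; the
  -- multiplier of the fixed point is unchanged.
  set g : ℂ → ℂ := fun w => mobius a (f (mobius (-a) w)) with hg
  have hmob0 : mobius (-a) 0 = a := by simp [mobius]
  have hmoba : mobius a a = 0 := by simp [mobius]
  have hg0 : g 0 = 0 := by simp [hg, hmob0, hfa, hmoba]
  have hin : ∀ w ∈ ball (0 : ℂ) 1, mobius (-a) w ∈ disc := fun w hw => by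
    simpa [disc] using norm_mobius_lt_one hna' (mem_ball_zero_iff.1 hw)
  have hfd : ∀ w ∈ disc, HasDerivAt f (deriv f w) w := fun w hw =>
    (hf.differentiableAt (isOpen_ball.mem_nhds hw)).hasDerivAt
  have hgd : ∀ w ∈ ball (0 : ℂ) 1, HasDerivAt g
      ((1 - conj a * a) / (1 - conj a * f (mobius (-a) w)) ^ 2 * (deriv f (mobius (-a) w) *
        ((1 - conj (-a) * (-a)) / (1 - conj (-a) * w) ^ 2))) w := fun w hw => by
    refine HasDerivAt.comp (h₂ := mobius a) (h := fun w => f (mobius (-a) w)) w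
      (hasDerivAt_mobius ha' (hlt _ (hmaps (hin w hw)))) ?_
    exact (hfd _ (hin w hw)).comp w (hasDerivAt_mobius hna' (mem_ball_zero_iff.1 hw))
  have hgdiff : DifferentiableOn ℂ g (ball 0 1) := fun w hw =>
    (hgd w hw).differentiableAt.differentiableWithinAt
  have hgmaps : MapsTo g (ball 0 1) (closedBall (g 0) ρ) := fun w hw => by
    rw [hg0, mem_closedBall_zero_iff]
    exact hρ _ (hmaps (hin w hw))
  constructor
  · have h1 := Complex.norm_deriv_le_div_of_mapsTo_ball hgdiff hgmaps one_pos
    rw [(hgd 0 (by simp)).deriv, hmob0, hfa, div_one] at h1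
    have h2 := one_sub_conj_mul_ne_zero ha' ha'
    have h3 : (1 - conj a * a) / (1 - conj a * a) ^ 2 *
        (deriv f a * ((1 - conj (-a) * -a) / (1 - conj (-a) * 0) ^ 2)) = deriv f a := by
      simp only [map_neg, neg_mul, mul_neg, neg_neg, mul_zero, sub_zero, one_pow, div_one]
      field_simp
    rw [h3] at h1
    exact h1.trans_lt hρ1
  · intro b hb hfb
    have hb' : ‖b‖ < 1 := by simpa [disc] using hb
    have hm := norm_mobius_lt_one ha' hb'
    have h1 := Complex.dist_le_div_mul_dist_of_mapsTo_ball hgdiff hgmaps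
      (mem_ball_zero_iff.2 hm)
    have hgb : g (mobius a b) = mobius a b := by
      simp only [hg, mobius_neg_mobius ha' hb', hfb]
    rw [hgb, hg0, dist_zero_right, div_one] at h1
    have h0 : mobius a b = 0 := by
      rw [← norm_le_zero_iff]; nlinarith [norm_nonneg (mobius a b)]
    rw [← mobius_neg_mobius ha' hb', h0, hmob0]

/-! ### Characteristics and their inverse flow. -/

theorem isOpen_disc : IsOpen disc := isOpen_ball

theorem mem_disc {z : ℂ} : z ∈ disc ↔ ‖z‖ < 1 := mem_ball_zero_iff

/-- The map `w ↦ w exp (t u(w))`, the position at time `t` of the characteristic from `w`. -/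
noncomputable def charMap (u : ℂ → ℂ) (t w : ℂ) : ℂ := w * Complex.exp (t * u w)

section Flow

variable {u : ℂ → ℂ}

theorem charMap_eq_iff {t w z : ℂ} :
    charMap u t w = z ↔ z * Complex.exp (-(t * u w)) = w := by
  rw [charMap, Complex.exp_neg, ← div_eq_mul_inv, div_eq_iff (Complex.exp_ne_zero _), eq_comm]

theorem norm_exp_neg_le_one {t : ℝ} (ht : 0 ≤ t) {c : ℂ} (hc : 0 ≤ c.re) :
    ‖Complex.exp (-((t : ℂ) * c))‖ ≤ 1 := by
  rw [Complex.norm_exp, Real.exp_le_one_iff]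
  simp
  positivity

/-- Characteristics move outward. This confines preimages of a smaller ball to that ball, the
properness needed for surjectivity. -/
theorem norm_le_norm_charMap (hre : ∀ z ∈ disc, 0 ≤ (u z).re) {t : ℝ} (ht : 0 ≤ t) {w : ℂ}
    (hw : w ∈ disc) : ‖w‖ ≤ ‖charMap u t w‖ := by
  conv_lhs => rw [← charMap_eq_iff.1 (rfl : charMap u t w = charMap u t w), norm_mul]
  exact mul_le_of_le_one_right (norm_nonneg _) (norm_exp_neg_le_one ht (hre w hw))

theorem hasDerivAt_charMap (hu : DifferentiableOn ℂ u disc) (t : ℂ) {w : ℂ} (hw : w ∈ disc) :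
    HasDerivAt (charMap u t) (Complex.exp (t * u w) * (1 + t * w * deriv u w)) w := by
  have h := (hu.differentiableAt (isOpen_disc.mem_nhds hw)).hasDerivAt
  convert! (hasDerivAt_id w).mul ((h.const_mul t).cexp) using 1
  simp only [id]
  ring

theorem continuousOn_charMap (hu : DifferentiableOn ℂ u disc) (t : ℂ) :
    ContinuousOn (charMap u t) disc := fun _ hw =>
  (hasDerivAt_charMap hu t hw).continuousAt.continuousWithinAt

/-- The map `f` below has `a` as a fixed point with multiplier `-t a u'(a)`; were `1 + t a u'(a)`
zero, the multiplier would be `1`, not attracting. -/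
theorem charMap_injOn_and_nondegenerate (hu : DifferentiableOn ℂ u disc)
    (hre : ∀ z ∈ disc, 0 ≤ (u z).re) {t : ℝ} (ht : 0 ≤ t) {a : ℂ} (ha : a ∈ disc)
    (hz : charMap u t a ∈ disc) :
    1 + t * a * deriv u a ≠ 0 ∧ ∀ b ∈ disc, charMap u t b = charMap u t a → b = a := by
  set z := charMap u t a with hzdef
  set f : ℂ → ℂ := fun w => z * Complex.exp (-(t * u w)) with hf
  have hfd : ∀ w ∈ disc, HasDerivAt f (z * (Complex.exp (-(t * u w)) * -(t * deriv u w))) w :=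
    fun w hw => by
      have h := (hu.differentiableAt (isOpen_disc.mem_nhds hw)).hasDerivAt
      exact ((h.const_mul (t : ℂ)).neg.cexp).const_mul z
  have hmaps : MapsTo f disc (closedBall 0 ‖z‖) := fun w hw => by
    rw [mem_closedBall_zero_iff, hf, norm_mul]
    exact mul_le_of_le_one_right (norm_nonneg _) (norm_exp_neg_le_one ht (hre w hw))
  have hfa : f a = a := charMap_eq_iff.1 rfl
  obtain ⟨h1, h2⟩ := fixedPoint_of_mapsTo_closedBall (mem_disc.1 hz)
    (fun w hw => (hfd w hw).differentiableAt.differentiableWithinAt) hmaps ha hfa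
  refine ⟨fun h0 => ?_, fun b hb hba => h2 b hb (charMap_eq_iff.1 hba)⟩
  have h3 : deriv f a = 1 := by
    rw [(hfd a ha).deriv, ← mul_assoc]
    change f a * _ = 1
    rw [hfa]
    linear_combination -h0
  rw [h3, norm_one] at h1
  exact lt_irrefl _ h1

/-- The part of the image inside the disc is open by the inverse function theorem and relatively
closed by properness, hence is the whole connected disc. -/
theorem exists_charMap_eq (hu : DifferentiableOn ℂ u disc)
    (hre : ∀ z ∈ disc, 0 ≤ (u z).re) {t : ℝ} (ht : 0 ≤ t) {z : ℂ} (hz : z ∈ disc) :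
    ∃ w ∈ disc, charMap u t w = z := by
  set U : Set ℂ := charMap u t '' disc ∩ disc with hU
  have hopen : IsOpen U := by
    rw [isOpen_iff_mem_nhds]
    rintro _ ⟨⟨w, hw, rfl⟩, hz⟩
    refine inter_mem ?_ (isOpen_disc.mem_nhds hz)
    have hs : HasStrictDerivAt (charMap u t) (deriv (charMap u t) w) w :=
      DifferentiableOn.analyticAt (s := disc) (fun v hv =>
        (hasDerivAt_charMap hu t hv).differentiableAt.differentiableWithinAt)
        (isOpen_disc.mem_nhds hw) |>.hasStrictDerivAt
    rw [← hs.map_nhds_eq]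
    · exact image_mem_map (isOpen_disc.mem_nhds hw)
    · rw [(hasDerivAt_charMap hu t hw).deriv]
      exact mul_ne_zero (Complex.exp_ne_zero _) (charMap_injOn_and_nondegenerate hu hre ht hw hz).1
  have hsub : disc ⊆ U := by
    refine (convex_ball (0 : ℂ) 1).isPreconnected.subset_of_closure_inter_subset hopen
      ⟨0, by simp, ⟨0, by simp [disc], by simp [charMap]⟩, by simp [disc]⟩ ?_
    rintro z ⟨hzc, hzd⟩
    refine ⟨?_, hzd⟩
    obtain ⟨r, hzr, hr1⟩ := exists_between (mem_ball_zero_iff.1 hzd)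
    have hK : IsClosed (charMap u t '' closedBall 0 r) :=
      ((isCompact_closedBall (0 : ℂ) r).image_of_continuousOn
        ((continuousOn_charMap hu t).mono (closedBall_subset_ball hr1))).isClosed
    have hsubK : ball 0 r ∩ U ⊆ charMap u t '' closedBall 0 r := by
      rintro _ ⟨hr, ⟨w, hw, rfl⟩, -⟩
      refine ⟨w, ?_, rfl⟩
      rw [mem_closedBall_zero_iff]
      exact (norm_le_norm_charMap hre ht hw).trans (mem_ball_zero_iff.1 hr).le
    have := closure_minimal hsubK hK (isOpen_ball.inter_closure ⟨mem_ball_zero_iff.2 hzr, hzc⟩)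
    exact image_mono (closedBall_subset_ball hr1) this
  exact (hsub hz).1

open Classical in
/-- The inverse of `charMap u t` on the disc. -/
noncomputable def flow (u : ℂ → ℂ) (t : ℝ) (z : ℂ) : ℂ :=
  if h : ∃ w ∈ disc, charMap u t w = z then Classical.choose h else 0

theorem flow_spec (hu : DifferentiableOn ℂ u disc) (hre : ∀ z ∈ disc, 0 ≤ (u z).re)
    {t : ℝ} (ht : 0 ≤ t) {z : ℂ} (hz : z ∈ disc) :
    flow u t z ∈ disc ∧ charMap u t (flow u t z) = z := by
  have h := exists_charMap_eq hu hre ht hz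
  rw [flow, dif_pos h]
  exact Classical.choose_spec h

theorem flow_eq_of_charMap_eq (hu : DifferentiableOn ℂ u disc) (hre : ∀ z ∈ disc, 0 ≤ (u z).re)
    {t : ℝ} (ht : 0 ≤ t) {z w : ℂ} (hz : z ∈ disc) (hw : w ∈ disc) (h : charMap u t w = z) :
    flow u t z = w := by
  have h1 := flow_spec hu hre ht hz
  subst h
  exact (charMap_injOn_and_nondegenerate hu hre ht hw hz).2 _ h1.1 h1.2

/-- Near a point with `t ≥ 0`, the flow extends to a holomorphic function of `(t, z)`. -/
theorem exists_local_flow (hu : DifferentiableOn ℂ u disc) (hre : ∀ z ∈ disc, 0 ≤ (u z).re)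
    {t : ℝ} (ht : 0 ≤ t) {z : ℂ} (hz : z ∈ disc) :
    ∃ ψ : ℂ × ℂ → ℂ, DifferentiableAt ℂ ψ (t, z) ∧ ψ (t, z) = flow u t z ∧
      ∀ᶠ p in 𝓝 ((t : ℂ), z), ψ p ∈ disc ∧ charMap u p.1 (ψ p) = p.2 := by
  obtain ⟨hw, hwz⟩ := flow_spec hu hre ht hz
  set w := flow u t z with hwdef
  have hnd := (charMap_injOn_and_nondegenerate hu hre ht hw (hwz.symm ▸ hz)).1
  -- Time is complexified, so that one holomorphic implicit function handles time and space
  -- together.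
  set f : (ℂ × ℂ) × ℂ → ℂ := fun q => charMap u q.1.1 q.2 - q.1.2 with hf
  have hua : AnalyticAt ℂ u w := hu.analyticAt (isOpen_disc.mem_nhds hw)
  have hfa : AnalyticAt ℂ f (((t : ℂ), z), w) := by
    have h1 : AnalyticAt ℂ (fun q : (ℂ × ℂ) × ℂ => u q.2) (((t : ℂ), z), w) :=
      AnalyticAt.fun_comp (f := fun q : (ℂ × ℂ) × ℂ => q.2) hua analyticAt_snd
    have h2 : AnalyticAt ℂ (fun q : (ℂ × ℂ) × ℂ => q.1.1) (((t : ℂ), z), w) :=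
      analyticAt_fst.fun_comp analyticAt_fst
    have h3 : AnalyticAt ℂ (fun q : (ℂ × ℂ) × ℂ => q.1.2) (((t : ℂ), z), w) :=
      analyticAt_snd.fun_comp analyticAt_fst
    exact (analyticAt_snd.mul (h2.mul h1).cexp).sub h3
  have hfs := hfa.hasStrictFDerivAt
  set f' := fderiv ℂ f (((t : ℂ), z), w)
  set d : ℂ := Complex.exp (t * u w) * (1 + t * w * deriv u w) with hd
  have hd0 : d ≠ 0 := mul_ne_zero (Complex.exp_ne_zero _) hnd
  have hinr : f' ∘L ContinuousLinearMap.inr ℂ (ℂ × ℂ) ℂ =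
      (ContinuousLinearEquiv.unitsEquivAut ℂ (Units.mk0 d hd0) : ℂ →L[ℂ] ℂ) := by
    have h1 : HasFDerivAt (fun v : ℂ => f (((t : ℂ), z), v))
        (f' ∘L ContinuousLinearMap.inr ℂ (ℂ × ℂ) ℂ) w :=
      HasFDerivAt.comp w (f := fun v : ℂ => (((t : ℂ), z), v)) hfs.hasFDerivAt
        (hasFDerivAt_prodMk_right ((t : ℂ), z) w)
    have h2 := ((hasDerivAt_charMap hu t hw).sub_const z).hasFDerivAt
    refine (h1.unique h2).trans ?_
    ext
    simp [hd]
  have hinv : (f' ∘L ContinuousLinearMap.inr ℂ (ℂ × ℂ) ℂ).IsInvertible := ⟨_, hinr.symm⟩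
  have hf0 : f (((t : ℂ), z), w) = 0 := by simp [hf, hwz]
  have htend := hfs.tendsto_implicitFunctionOfProdDomain hinv
  have hψd := (hfs.hasStrictFDerivAt_implicitFunctionOfProdDomain hinv).hasFDerivAt.differentiableAt
  refine ⟨hfs.implicitFunctionOfProdDomain hinv, hψd, ?_, ?_⟩
  · exact tendsto_nhds_unique hψd.continuousAt.tendsto htend
  · filter_upwards [hfs.eventually_apply_implicitFunctionOfProdDomain hinv,
      htend.eventually (isOpen_disc.mem_nhds hw)] with p hp hpd
    refine ⟨hpd, ?_⟩
    rw [hf0] at hp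
    exact sub_eq_zero.1 hp

theorem tendsto_ofReal_prod_nhds {t : ℝ} {z : ℂ} {s : Set (ℝ × ℂ)} :
    Tendsto (fun p : ℝ × ℂ => ((p.1 : ℂ), p.2)) (𝓝[s] (t, z)) (𝓝 ((t : ℂ), z)) :=
  (Continuous.tendsto (f := fun p : ℝ × ℂ => ((p.1 : ℂ), p.2)) (by fun_prop)
    (t, z)).mono_left nhdsWithin_le_nhds

/-- The local branch is the flow only for nonnegative times, where preimages are unique; hence the
one-sided neighbourhood. -/
theorem flow_eventuallyEq (hu : DifferentiableOn ℂ u disc) (hre : ∀ z ∈ disc, 0 ≤ (u z).re)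
    {t : ℝ} {z : ℂ} {ψ : ℂ × ℂ → ℂ} (hz : z ∈ disc)
    (hψ : ∀ᶠ p in 𝓝 ((t : ℂ), z), ψ p ∈ disc ∧ charMap u p.1 (ψ p) = p.2) :
    ∀ᶠ p : ℝ × ℂ in 𝓝[Ici 0 ×ˢ univ] (t, z), flow u p.1 p.2 = ψ (p.1, p.2) := by
  have h3 : ∀ᶠ p : ℝ × ℂ in 𝓝[Ici 0 ×ˢ univ] (t, z), p.2 ∈ disc :=
    (continuous_snd.continuousAt (x := (t, z))).continuousWithinAt.eventually
      (isOpen_disc.mem_nhds hz)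
  filter_upwards [tendsto_ofReal_prod_nhds.eventually hψ, self_mem_nhdsWithin, h3] with p h1 h2 h3
  exact flow_eq_of_charMap_eq hu hre h2.1 h3 h1.1 h1.2

theorem continuousOn_flow (hu : DifferentiableOn ℂ u disc) (hre : ∀ z ∈ disc, 0 ≤ (u z).re) :
    ContinuousOn (fun p : ℝ × ℂ => flow u p.1 p.2) (Ici 0 ×ˢ disc) := by
  rintro ⟨t, z⟩ ⟨ht, hz⟩
  obtain ⟨ψ, hψd, hψ0, hψ⟩ := exists_local_flow hu hre ht hz
  have h := flow_eventuallyEq hu hre hz hψ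
  refine ContinuousWithinAt.mono (t := Ici 0 ×ˢ univ) ?_ (prod_mono_right (subset_univ _))
  refine ContinuousWithinAt.congr_of_eventuallyEq ?_ h hψ0.symm
  exact hψd.continuousAt.tendsto.comp tendsto_ofReal_prod_nhds

theorem flow_derivs (hu : DifferentiableOn ℂ u disc) (hre : ∀ z ∈ disc, 0 ≤ (u z).re)
    {t : ℝ} (ht : 0 ≤ t) {z : ℂ} (hz : z ∈ disc) :
    DifferentiableAt ℂ (flow u t) z ∧
      HasDerivWithinAt (fun s : ℝ => flow u s z) (-z * u (flow u t z) * deriv (flow u t) z)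
        (Ici 0) t := by
  obtain ⟨ψ, hψd, hψ0, hψ⟩ := exists_local_flow hu hre ht hz
  have h := flow_eventuallyEq hu hre hz hψ
  have hw := (flow_spec hu hre ht hz).1
  have hwz := (flow_spec hu hre ht hz).2
  set w := flow u t z with hwdef
  have hz_in : Tendsto (fun v : ℂ => (t, v)) (𝓝 z) (𝓝[Ici 0 ×ˢ univ] (t, z)) :=
    tendsto_nhdsWithin_iff.2 ⟨Continuous.tendsto (by fun_prop) z, .of_forall fun v => ⟨ht, trivial⟩⟩
  have ht_in : Tendsto (fun s : ℝ => (s, z)) (𝓝[Ici 0] t) (𝓝[Ici 0 ×ˢ univ] (t, z)) :=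
    tendsto_nhdsWithin_iff.2 ⟨(Continuous.tendsto (by fun_prop) t).mono_left nhdsWithin_le_nhds,
      by filter_upwards [self_mem_nhdsWithin] with s hs using ⟨hs, trivial⟩⟩
  have hzeq : flow u t =ᶠ[𝓝 z] fun v => ψ (t, v) := hz_in.eventually h
  have hteq : (fun s : ℝ => flow u s z) =ᶠ[𝓝[Ici 0] t] fun s => ψ (s, z) := ht_in.eventually h
  obtain ⟨a, ha⟩ : ∃ a, HasDerivAt (fun v => ψ (t, v)) a z :=
    ⟨_, (hψd.comp z (f := fun v : ℂ => ((t : ℂ), v)) (by fun_prop)).hasDerivAt⟩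
  obtain ⟨b, hb⟩ : ∃ b, HasDerivAt (fun s => ψ (s, z)) b (t : ℂ) :=
    ⟨_, (hψd.comp (t : ℂ) (f := fun s : ℂ => (s, z)) (by fun_prop)).hasDerivAt⟩
  have hud : HasDerivAt u (deriv u w) w :=
    (hu.differentiableAt (isOpen_disc.mem_nhds hw)).hasDerivAt
  -- `e1` and `e2` differentiate `charMap u s (ψ (s, v)) = v` in `v` and in `s`; eliminating `deriv
  -- u w` between them yields the transport equation.
  have e1 : Complex.exp (t * u w) * (1 + t * w * deriv u w) * a = 1 := by
    have h1 : HasDerivAt (fun v => charMap u t (ψ (t, v)))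
        (Complex.exp (t * u w) * (1 + t * w * deriv u w) * a) z := by
      have := hasDerivAt_charMap hu t hw
      rw [← hψ0] at this ⊢
      exact this.comp z ha
    refine h1.unique ((hasDerivAt_id z).congr_of_eventuallyEq ?_)
    have : Tendsto (fun v : ℂ => ((t : ℂ), v)) (𝓝 z) (𝓝 ((t : ℂ), z)) :=
      Continuous.tendsto (by fun_prop) z
    filter_upwards [this.eventually hψ] with v hv using hv.2
  have e2 : b * Complex.exp (t * u w) + w * (Complex.exp (t * u w) *
      (1 * u w + t * (deriv u w * b))) = 0 := by
    have h1 : HasDerivAt (fun s => charMap u s (ψ (s, z)))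
        (b * Complex.exp (t * u w) + w * (Complex.exp (t * u w) *
          (1 * u w + t * (deriv u w * b)))) (t : ℂ) := by
      rw [← hψ0] at hud ⊢
      exact hb.mul (((hasDerivAt_id (t : ℂ)).mul (hud.comp (t : ℂ) hb)).cexp)
    refine h1.unique ((hasDerivAt_const (t : ℂ) z).congr_of_eventuallyEq ?_)
    have : Tendsto (fun s : ℂ => (s, z)) (𝓝 (t : ℂ)) (𝓝 ((t : ℂ), z)) :=
      Continuous.tendsto (by fun_prop) _
    filter_upwards [this.eventually hψ] with v hv using hv.2
  have hda := ha.congr_of_eventuallyEq hzeq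
  refine ⟨hda.differentiableAt, ?_⟩
  rw [hda.deriv]
  have hba : -z * u w * a = b := by
    rw [← hwz, charMap]
    linear_combination b * e1 - a * e2
  rw [hba]
  have h2 : HasDerivWithinAt (fun s : ℝ => ψ (s, z)) b (Ici 0) t :=
    hb.comp_ofReal.hasDerivWithinAt
  exact h2.congr_of_eventuallyEq hteq hψ0.symm

end Flow

/-! ### The Herglotz representation theorem. -/

theorem one_sub_circle_mul_ne_zero (x : Circle) {z : ℂ} (hz : z ∈ disc) : 1 - (x : ℂ) * z ≠ 0 := by
  intro h0
  have h1 : ‖(x : ℂ) * z‖ = 1 := by rw [← sub_eq_zero.1 h0, norm_one]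
  rw [norm_mul, Circle.norm_coe, one_mul] at h1
  exact (mem_disc.1 hz).ne h1

theorem circleAverage_eq_center {f : ℂ → ℂ} (hf : ∀ ζ ∈ closedBall (0 : ℂ) 1, DifferentiableAt ℂ f ζ) :
    Real.circleAverage f 0 1 = f 0 := by
  refine circleAverage_of_differentiable_on_off_countable countable_empty ?_ ?_ <;>
  rw [abs_one]
  · exact fun ζ hζ => (hf ζ hζ).continuousAt.continuousWithinAt
  · exact fun ζ hζ => hf ζ (ball_subset_closedBall hζ.1)

theorem circleAverage_conj (f : ℂ → ℂ) :
    Real.circleAverage (fun ζ => conj (f ζ)) 0 1 = conj (Real.circleAverage f 0 1) := by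
  simp only [Real.circleAverage_def, Complex.real_smul, map_mul, Complex.conj_ofReal]
  congr 1
  simp only [intervalIntegral.integral_of_le Real.two_pi_pos.le, integral_conj]

/-- The Schwarz integral formula. -/
theorem circleAverage_re_mul_kernel {f : ℂ → ℂ}
    (hf : ∀ ζ ∈ closedBall (0 : ℂ) 1, DifferentiableAt ℂ f ζ) (hf0 : f 0 = 1) {z : ℂ}
    (hz : z ∈ disc) :
    Real.circleAverage (fun ζ => ((f ζ).re : ℂ) * ((ζ + z) / (ζ - z))) 0 1 = f z := by
  have hz1 := mem_disc.1 hz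
  have hfc : ContinuousOn f (closedBall 0 1) := fun ζ hζ =>
    (hf ζ hζ).continuousAt.continuousWithinAt
  have hden : ∀ ζ ∈ closedBall (0 : ℂ) 1, 1 - conj z * ζ ≠ 0 := fun ζ hζ h0 => by
    have h1 : conj z * ζ = 1 := (sub_eq_zero.1 h0).symm
    have h2 : ‖conj z * ζ‖ < 1 := by
      rw [norm_mul, RCLike.norm_conj]
      have := mem_closedBall_zero_iff.1 hζ
      nlinarith [norm_nonneg z, norm_nonneg ζ]
    rw [h1, norm_one] at h2
    exact lt_irrefl _ h2
  have hne : ∀ ζ ∈ sphere (0 : ℂ) 1, ζ - z ≠ 0 := fun ζ hζ h0 => by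
    rw [sub_eq_zero.1 h0, mem_sphere_zero_iff_norm] at hζ
    linarith
  have hss : sphere (0 : ℂ) 1 ⊆ closedBall 0 1 := sphere_subset_closedBall
  -- With `k = ζ / (ζ - z)` the kernel is `2k - 1`, so the integrand is `k f + k conj f - f/2 - conj
  -- f/2`; the averages are `f z`, `1`, `1/2`, `1/2`.
  have e1 : Real.circleAverage (fun ζ => (ζ / (ζ - z)) * f ζ) 0 1 = f z := by
    have := circleAverage_sub_sub_inv_smul_of_differentiable_on_off_countable (c := 0) (R := 1)
      (w := z) (f := f) (s := ∅) countable_empty (by rwa [abs_one])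
      (fun ζ hζ => hf ζ (by rw [abs_one] at hζ; exact ball_subset_closedBall hζ.1))
      (by rw [abs_one]; exact hz)
    simpa using this
  have e2 : Real.circleAverage (fun ζ => (ζ / (ζ - z)) * conj (f ζ)) 0 1 = 1 := by
    -- Since `conj ζ = 1/ζ` on the circle, `k conj f` is the conjugate of this quotient, which is
    -- holomorphic on the closed disc.
    have h1 : Real.circleAverage (fun ζ => f ζ / (1 - conj z * ζ)) 0 1 = 1 := by
      rw [circleAverage_eq_center, hf0]
      · simp
      · exact fun ζ hζ => (hf ζ hζ).div (by fun_prop) (hden ζ hζ)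
    rw [← map_one (starRingEnd ℂ), ← h1, ← circleAverage_conj]
    refine Real.circleAverage_congr_sphere fun ζ hζ => ?_
    rw [abs_one] at hζ
    have h2 : conj ζ * ζ = 1 := by
      rw [Complex.conj_mul', mem_sphere_zero_iff_norm.1 hζ]; simp
    have h3 := hne ζ hζ
    have h4 : 1 - z * conj ζ ≠ 0 := by
      intro h0; apply h3
      linear_combination ζ * h0 + z * h2
    simp only [map_div₀, map_sub, map_one, map_mul, Complex.conj_conj]
    rw [div_mul_eq_mul_div, div_eq_div_iff h3 h4]
    linear_combination (-z * conj (f ζ)) * h2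
  have e3 : Real.circleAverage f 0 1 = 1 := by rw [circleAverage_eq_center hf, hf0]
  have e4 : Real.circleAverage (fun ζ => conj (f ζ)) 0 1 = 1 := by
    rw [circleAverage_conj, e3, map_one]
  have ci : ∀ g : ℂ → ℂ, ContinuousOn g (sphere 0 1) → CircleIntegrable g 0 1 := fun g hg =>
    ContinuousOn.circleIntegrable' (by rwa [abs_one])
  have hfs : ContinuousOn f (sphere 0 1) := hfc.mono hss
  have hfsc : ContinuousOn (fun ζ => conj (f ζ)) (sphere 0 1) :=
    Complex.continuous_conj.comp_continuousOn hfs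
  have hk : ContinuousOn (fun ζ => ζ / (ζ - z)) (sphere 0 1) :=
    continuousOn_id.div (by fun_prop) hne
  have c1 : CircleIntegrable (fun ζ => (ζ / (ζ - z)) * f ζ) 0 1 := ci _ (hk.mul hfs)
  have c2 : CircleIntegrable (fun ζ => (ζ / (ζ - z)) * conj (f ζ)) 0 1 := ci _ (hk.mul hfsc)
  have c3 := (ci _ hfs).const_smul (a := (1 / 2 : ℂ))
  have c4 := (ci _ hfsc).const_smul (a := (1 / 2 : ℂ))
  have hsplit : Real.circleAverage (fun ζ => ((f ζ).re : ℂ) * ((ζ + z) / (ζ - z))) 0 1 =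
      Real.circleAverage ((((fun ζ => (ζ / (ζ - z)) * f ζ) +
        (fun ζ => (ζ / (ζ - z)) * conj (f ζ))) -
        (1 / 2 : ℂ) • f) - (1 / 2 : ℂ) • (fun ζ => conj (f ζ))) 0 1 := by
    refine Real.circleAverage_congr_sphere fun ζ hζ => ?_
    rw [abs_one] at hζ
    have h3 := hne ζ hζ
    simp only [Pi.add_apply, Pi.sub_apply, Pi.smul_apply, smul_eq_mul, Complex.re_eq_add_conj]
    field_simp
    ring
  rw [hsplit, Real.circleAverage_sub ((c1.add c2).sub c3) c4,
    Real.circleAverage_sub (c1.add c2) c3, Real.circleAverage_add c1 c2,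
    Real.circleAverage_smul, Real.circleAverage_smul, e1, e2, e3, e4]
  simp
  ring

/-- The measure on the circle with density `Re f(1/x)` with respect to the Haar measure. -/
theorem exists_measure_of_differentiableAt {f : ℂ → ℂ}
    (hf : ∀ ζ ∈ closedBall (0 : ℂ) 1, DifferentiableAt ℂ f ζ) (hf0 : f 0 = 1)
    (hre : ∀ ζ ∈ closedBall (0 : ℂ) 1, 0 ≤ (f ζ).re) :
    ∃ μ : ProbabilityMeasure Circle, ∀ z ∈ disc,
      ∫ x : Circle, (1 + x * z) / (1 - x * z) ∂(μ : Measure Circle) = f z := by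
  have hcirc : ∀ θ : ℝ, circleMap 0 1 θ ∈ closedBall (0 : ℂ) 1 := fun θ =>
    sphere_subset_closedBall (circleMap_mem_sphere 0 zero_le_one θ)
  set ρ : ℝ → NNReal := fun θ => Real.toNNReal ((2 * Real.pi)⁻¹ * (f (circleMap 0 1 θ)).re) with hρ
  have hρcoe : ∀ θ, (ρ θ : ℝ) = (2 * Real.pi)⁻¹ * (f (circleMap 0 1 θ)).re := fun θ =>
    Real.coe_toNNReal _ (mul_nonneg (by positivity) (hre _ (hcirc θ)))
  have hρc : Continuous ρ := by
    refine continuous_real_toNNReal.comp (continuous_const.mul (Complex.continuous_re.comp ?_))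
    exact continuous_iff_continuousAt.2 fun θ =>
      (hf _ (hcirc θ)).continuousAt.comp (f := circleMap 0 1) (continuous_circleMap 0 1).continuousAt
  -- The inversion turns the kernel `(1 + xz)/(1 - xz)` into the Schwarz kernel `(ζ + z)/(ζ - z)`.
  set e : ℝ → Circle := fun θ => (Circle.exp θ)⁻¹ with he
  have hec : Continuous e := Circle.exp.continuous.inv
  set m : Measure Circle :=
    ((volume.restrict (Ioc 0 (2 * Real.pi))).withDensity (fun θ => (ρ θ : ENNReal))).map e with hm
  have hint : ∀ (g : Circle → ℂ) (G : ℂ → ℂ), Continuous g → (∀ x : Circle, G x = g x⁻¹) →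
      ∫ x, g x ∂m = Real.circleAverage (fun ζ => ((f ζ).re : ℂ) * G ζ) 0 1 := by
    intro g G hg hG
    rw [hm, integral_map hec.aemeasurable hg.aestronglyMeasurable,
      integral_withDensity_eq_integral_smul hρc.measurable, Real.circleAverage_def,
      intervalIntegral.integral_of_le Real.two_pi_pos.le, ← integral_smul]
    congr 1
    ext θ
    have h2 : circleMap 0 1 θ = (Circle.exp θ : ℂ) := by simp [circleMap]
    rw [NNReal.smul_def, hρcoe, Complex.real_smul, Complex.real_smul, h2, hG]
    push_cast
    ring
  have hlin : ∫⁻ θ in Ioc 0 (2 * Real.pi), (ρ θ : ENNReal) = 1 := by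
    have hci : CircleIntegrable f 0 1 := ContinuousOn.circleIntegrable' fun ζ hζ =>
      (hf ζ (by rw [abs_one] at hζ; exact sphere_subset_closedBall hζ)).continuousAt.continuousWithinAt
    have h1 : Real.circleAverage (fun ζ => (f ζ).re) 0 1 = 1 := by
      have := Complex.reCLM.circleAverage_comp_comm hci
      rw [circleAverage_eq_center hf, hf0] at this
      simpa [Function.comp_def] using this
    have h2 : ∫ θ in Ioc 0 (2 * Real.pi), (ρ θ : ℝ) = 1 := by
      rw [← h1, Real.circleAverage_def, intervalIntegral.integral_of_le Real.two_pi_pos.le,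
        ← integral_smul]
      exact integral_congr_ae (.of_forall hρcoe)
    have h3 : Integrable (fun θ => (ρ θ : ℝ)) (volume.restrict (Ioc 0 (2 * Real.pi))) :=
      (NNReal.continuous_coe.comp hρc).integrableOn_Ioc
    rw [← ENNReal.ofReal_one, ← h2,
      ofReal_integral_eq_lintegral_ofReal h3 (.of_forall fun θ => NNReal.coe_nonneg _)]
    simp
  have hprob : IsProbabilityMeasure m := by
    constructor
    rw [hm, Measure.map_apply hec.measurable MeasurableSet.univ, preimage_univ,
      withDensity_apply _ MeasurableSet.univ, Measure.restrict_univ, hlin]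
  refine ⟨⟨m, hprob⟩, fun z hz => ?_⟩
  change ∫ x, _ ∂m = _
  rw [← circleAverage_re_mul_kernel hf hf0 hz]
  refine hint _ _ (Continuous.div (by fun_prop) (by fun_prop)
    fun x => one_sub_circle_mul_ne_zero x hz) fun x => ?_
  rw [Circle.coe_inv, ← div_eq_inv_mul, one_add_div x.coe_ne_zero, one_sub_div x.coe_ne_zero,
    div_div_div_cancel_right₀ x.coe_ne_zero]

/-- The **Herglotz representation theorem**, for functions normalized at the origin. -/
theorem exists_herglotz_measure {F : ℂ → ℂ} (hF : DifferentiableOn ℂ F disc) (hF0 : F 0 = 1)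
    (hre : ∀ z ∈ disc, 0 ≤ (F z).re) :
    ∃ μ : ProbabilityMeasure Circle, ∀ z ∈ disc,
      ∫ x : Circle, (1 + x * z) / (1 - x * z) ∂(μ : Measure Circle) = F z := by
  -- The dilations `F (r n * z)` are holomorphic up to the boundary; their measures have a weak
  -- limit along an ultrafilter, by compactness.
  obtain ⟨r, -, hr, hrlim⟩ := exists_seq_strictMono_tendsto' (zero_lt_one (α := ℝ))
  have hscale : ∀ n, ∀ ζ ∈ closedBall (0 : ℂ) 1, (r n : ℂ) * ζ ∈ disc := fun n ζ hζ => by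
    have h1 := mem_closedBall_zero_iff.1 hζ
    rw [mem_disc, norm_mul, Complex.norm_real, Real.norm_of_nonneg (hr n).1.le]
    exact (mul_le_of_le_one_right (hr n).1.le h1).trans_lt (hr n).2
  have hex : ∀ n, ∃ μ : ProbabilityMeasure Circle, ∀ z ∈ disc,
      ∫ x : Circle, (1 + x * z) / (1 - x * z) ∂(μ : Measure Circle) = F (r n * z) := fun n =>
    exists_measure_of_differentiableAt (f := fun z => F (r n * z))
      (fun ζ hζ => DifferentiableAt.comp ζ (f := fun z => (r n : ℂ) * z)
        (hF.differentiableAt (isOpen_disc.mem_nhds (hscale n ζ hζ))) (by fun_prop))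
      (by simp [hF0]) (fun ζ hζ => hre _ (hscale n ζ hζ))
  choose m hm using hex
  obtain ⟨μ, -, hμ⟩ := isCompact_univ.ultrafilter_le_nhds
    ((hyperfilter ℕ).map m) (by simp)
  have hlim : Tendsto m (hyperfilter ℕ) (𝓝 μ) := hμ
  refine ⟨μ, fun z hz => ?_⟩
  have h1 := (ProbabilityMeasure.tendsto_iff_forall_integral_rclike_tendsto ℂ).1 hlim
    (BoundedContinuousFunction.mkOfCompact ⟨fun x : Circle => (1 + x * z) / (1 - x * z),
      Continuous.div (by fun_prop) (by fun_prop) fun x => one_sub_circle_mul_ne_zero x hz⟩)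
  simp only [BoundedContinuousFunction.mkOfCompact_apply, ContinuousMap.coe_mk, hm _ z hz] at h1
  have h2 : Tendsto (fun n => F (r n * z)) atTop (𝓝 (F z)) := by
    refine (hF.continuousOn.continuousAt (isOpen_disc.mem_nhds hz)).tendsto.comp ?_
    have := (Complex.continuous_ofReal.tendsto 1).comp hrlim
    simpa using this.mul_const z
  exact tendsto_nhds_unique h1 (h2.mono_left Nat.hyperfilter_le_atTop)

theorem continuous_psi_integrand {z : ℂ} (hz : z ∈ disc) :
    Continuous fun x : Circle => ((x : ℂ) * z) / (1 - (x : ℂ) * z) :=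
  Continuous.div (by fun_prop) (by fun_prop) fun x => one_sub_circle_mul_ne_zero x hz

theorem integrable_circle (μ : ProbabilityMeasure Circle) {f : Circle → ℂ} (hf : Continuous f) :
    Integrable f (μ : Measure Circle) :=
  hf.integrable_of_hasCompactSupport (HasCompactSupport.of_compactSpace f)

/-! ### Weak continuity from continuity of `ψ`. -/

section WeakContinuity

variable {X : Type*} [TopologicalSpace X]

/-- The continuous functions whose integrals against `m t` depend continuously on `t`. -/
def weakTest (m : X → ProbabilityMeasure Circle) : Submodule ℂ (Circle → ℂ) where
  carrier := {f | Continuous f ∧ Continuous fun t => ∫ x, f x ∂(m t : Measure Circle)}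
  zero_mem' := ⟨continuous_zero, by simpa using continuous_const⟩
  add_mem' := by
    rintro f g ⟨hf, hf'⟩ ⟨hg, hg'⟩
    refine ⟨hf.add hg, ?_⟩
    simp only [Pi.add_apply, integral_add (integrable_circle _ hf) (integrable_circle _ hg)]
    exact hf'.add hg'
  smul_mem' := by
    rintro c f ⟨hf, hf'⟩
    refine ⟨hf.const_smul c, ?_⟩
    simp only [Pi.smul_apply, integral_smul]
    exact hf'.const_smul c

variable {m : X → ProbabilityMeasure Circle}

theorem mem_weakTest_of_approx {f : Circle → ℂ} (hf : Continuous f)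
    (h : ∀ ε > 0, ∃ g ∈ weakTest m, ∀ x, ‖f x - g x‖ ≤ ε) : f ∈ weakTest m := by
  refine ⟨hf, continuous_of_uniform_approx_of_continuous fun U hU => ?_⟩
  obtain ⟨ε, hε, hεU⟩ := Metric.mem_uniformity_dist.1 hU
  obtain ⟨g, hg, hfg⟩ := h (ε / 2) (half_pos hε)
  refine ⟨_, hg.2, fun t => hεU ?_⟩
  rw [dist_eq_norm, ← integral_sub (integrable_circle _ hf) (integrable_circle _ hg.1)]
  refine (norm_integral_le_of_norm_le_const (.of_forall hfg)).trans_lt ?_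
  simpa using hε

/-- Removing the terms below `n` from the geometric series of `1/(1 - δx)` and dividing by `δ ^ n`
leaves `x ^ n / (1 - δx)`, uniformly close to `x ^ n` for small `δ`. The removed terms are covered
by induction. -/
theorem pow_mem_weakTest (h : ∀ z ∈ disc, Continuous fun t => psi (m t) z) (n : ℕ) :
    (fun x : Circle => (x : ℂ) ^ n) ∈ weakTest m := by
  have h1 : (fun _ => 1 : Circle → ℂ) ∈ weakTest m :=
    ⟨continuous_const, by simpa using continuous_const⟩
  induction n using Nat.strong_induction_on with
  | _ n ih =>
    refine mem_weakTest_of_approx (by fun_prop) fun ε hε => ?_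
    -- Chosen so that the error bound `δ / (1 - δ)` equals `ε`.
    set δ : ℝ := ε / (1 + ε) with hδ
    have hδ0 : 0 < δ := by positivity
    have hδ1 : δ < 1 := by rw [hδ, div_lt_one (by positivity)]; linarith
    have hδε : δ = ε * (1 - δ) := by rw [hδ]; field_simp; ring
    have hδn : ‖(δ : ℂ)‖ = δ := by rw [Complex.norm_real, Real.norm_of_nonneg hδ0.le]
    have hz : (δ : ℂ) ∈ disc := mem_disc.2 (hδn.trans_lt hδ1)
    have hδc : (δ : ℂ) ≠ 0 := by exact_mod_cast hδ0.ne'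
    have hk : (fun x : Circle => ((x : ℂ) * δ) / (1 - (x : ℂ) * δ)) ∈ weakTest m :=
      ⟨continuous_psi_integrand hz, h _ hz⟩
    refine ⟨((δ : ℂ) ^ n)⁻¹ • ((fun _ => 1 : Circle → ℂ) +
      (fun x : Circle => ((x : ℂ) * δ) / (1 - (x : ℂ) * δ)) -
        ∑ k ∈ Finset.range n, (δ : ℂ) ^ k • fun x : Circle => (x : ℂ) ^ k), ?_, fun x => ?_⟩
    · refine Submodule.smul_mem _ _ (Submodule.sub_mem _ (Submodule.add_mem _ h1 hk) ?_)
      exact Submodule.sum_mem _ fun k hk =>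
        Submodule.smul_mem _ _ (ih k (Finset.mem_range.1 hk))
    · have hden := one_sub_circle_mul_ne_zero x hz
      have hgeom : ∑ k ∈ Finset.range n, (δ : ℂ) ^ k * (x : ℂ) ^ k =
          (1 - (x * δ) ^ n) / (1 - x * δ) := by
        rw [eq_div_iff hden, ← neg_sub, mul_neg, ← neg_sub _ (1 : ℂ), neg_inj]
        rw [← geom_sum_mul]
        congr 1
        exact Finset.sum_congr rfl fun k _ => by rw [mul_pow, mul_comm]
      have heq : (x : ℂ) ^ n - ((δ : ℂ) ^ n)⁻¹ * (1 + (x * δ) / (1 - x * δ) -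
          (1 - (x * δ) ^ n) / (1 - x * δ)) = - ((x : ℂ) ^ n * ((x * δ) / (1 - x * δ))) := by
        have hden' : 1 - (δ : ℂ) * x ≠ 0 := by rwa [mul_comm]
        field_simp
        ring
      simp only [Pi.smul_apply, Pi.sub_apply, Pi.add_apply, Finset.sum_apply, smul_eq_mul, hgeom]
      rw [heq, norm_neg, norm_mul, norm_pow, Circle.norm_coe, one_pow, one_mul, norm_div, norm_mul,
        Circle.norm_coe, one_mul, hδn]
      have hlow : 1 - δ ≤ ‖1 - (x : ℂ) * δ‖ := by
        have := norm_sub_norm_le (1 : ℂ) ((x : ℂ) * δ)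
        rwa [norm_one, norm_mul, Circle.norm_coe, one_mul, hδn] at this
      rw [div_le_iff₀ (by linarith)]
      calc δ = ε * (1 - δ) := hδε
        _ ≤ ε * ‖1 - (x : ℂ) * δ‖ := by gcongr

theorem conj_mem_weakTest {f : Circle → ℂ} (hf : f ∈ weakTest m) :
    (fun x => conj (f x)) ∈ weakTest m := by
  refine ⟨Complex.continuous_conj.comp hf.1, ?_⟩
  simp only [integral_conj]
  exact Complex.continuous_conj.comp hf.2

theorem zpow_mem_weakTest (h : ∀ z ∈ disc, Continuous fun t => psi (m t) z) (n : ℤ) :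
    (fun x : Circle => (x : ℂ) ^ n) ∈ weakTest m := by
  obtain ⟨k, rfl | rfl⟩ := n.eq_nat_or_neg
  · simpa using pow_mem_weakTest h k
  · convert! conj_mem_weakTest (pow_mem_weakTest h k) using 2 with x
    rw [zpow_neg, zpow_natCast, ← inv_pow, map_pow, ← Circle.coe_inv, Circle.coe_inv_eq_conj]

/-- Trigonometric polynomials are uniformly dense; their membership follows from that of the integer
powers. -/
theorem mem_weakTest_of_continuous (h : ∀ z ∈ disc, Continuous fun t => psi (m t) z)
    {f : Circle → ℂ} (hf : Continuous f) : f ∈ weakTest m := by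
  have : Fact (0 < 2 * Real.pi) := ⟨Real.two_pi_pos⟩
  set e := AddCircle.homeomorphCircle (T := 2 * Real.pi) Real.two_pi_pos.ne' with he
  refine mem_weakTest_of_approx hf fun ε hε => ?_
  set F : C(AddCircle (2 * Real.pi), ℂ) := ⟨f ∘ e, hf.comp e.continuous⟩ with hF
  have hmem : F ∈ closure (Submodule.span ℂ (range (@fourier (2 * Real.pi))) : Set _) := by
    rw [← Submodule.topologicalClosure_coe, span_fourier_closure_eq_top]
    trivial
  obtain ⟨p, hp, hFp⟩ := Metric.mem_closure_iff.1 hmem ε hε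
  refine ⟨p ∘ e.symm, ?_, fun x => ?_⟩
  · clear hFp
    induction hp using Submodule.span_induction with
    | mem q hq =>
      obtain ⟨n, rfl⟩ := hq
      convert! zpow_mem_weakTest h n using 2 with x
      obtain ⟨θ, rfl⟩ := e.surjective x
      simp only [Function.comp_apply, Homeomorph.symm_apply_apply, fourier_apply,
        AddCircle.toCircle_zsmul, Circle.coe_zpow]
      rw [he, AddCircle.homeomorphCircle_apply]
    | zero => exact Submodule.zero_mem _
    | add p q _ _ hp hq => exact Submodule.add_mem _ hp hq
    | smul c p _ hp => exact Submodule.smul_mem _ c hp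
  · have h1 := (ContinuousMap.norm_coe_le_norm (F - p) (e.symm x)).trans
      ((dist_eq_norm F p).symm.le.trans hFp.le)
    simpa [hF] using h1

theorem continuous_of_continuous_psi (h : ∀ z ∈ disc, Continuous fun t => psi (m t) z) :
    Continuous m := by
  refine continuous_iff_continuousAt.2 fun t => ?_
  refine (ProbabilityMeasure.tendsto_iff_forall_integral_rclike_tendsto ℂ).2 fun f => ?_
  exact (mem_weakTest_of_continuous h f.continuous).2.tendsto t

end WeakContinuity

/-! ### Self-maps of the disc as `η`-transforms. -/

theorem integral_kernel_eq (μ : ProbabilityMeasure Circle) {z : ℂ} (hz : z ∈ disc) :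
    ∫ x : Circle, (1 + x * z) / (1 - x * z) ∂(μ : Measure Circle) = 1 + 2 * psi μ z := by
  have h1 : ∀ x : Circle, (1 + (x : ℂ) * z) / (1 - x * z) = 1 + 2 * ((x * z) / (1 - x * z)) :=
    fun x => by
      have := one_sub_circle_mul_ne_zero x hz
      rw [div_eq_iff this, add_mul, mul_assoc, div_mul_cancel₀ _ this]
      ring
  simp only [h1]
  rw [integral_add (integrable_const _)
    ((integrable_circle μ (continuous_psi_integrand hz)).const_mul 2), integral_const_mul]
  simp [psi]

theorem psi_dirac_one {μ : ProbabilityMeasure Circle} (hμ : (μ : Measure Circle) = Measure.dirac 1)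
    (z : ℂ) : psi μ z = z / (1 - z) := by
  rw [psi, hμ, integral_dirac]
  simp

/-- Every holomorphic self-map of the disc fixing `0` is an `η`-transform. -/
theorem exists_psi_eq {f : ℂ → ℂ} (hf : DifferentiableOn ℂ f disc) (hmaps : MapsTo f disc disc)
    (hf0 : f 0 = 0) : ∃ μ : ProbabilityMeasure Circle, ∀ z ∈ disc, psi μ z = f z / (1 - f z) := by
  have hne : ∀ z ∈ disc, 1 - f z ≠ 0 := fun z hz => by
    simpa using one_sub_circle_mul_ne_zero 1 (hmaps hz)
  obtain ⟨μ, hμ⟩ := exists_herglotz_measure (F := fun z => (1 + f z) / (1 - f z))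
    ((hf.const_add 1).div (hf.const_sub 1) hne) (by simp [hf0]) (fun z hz => by
      have h1 := mem_disc.1 (hmaps hz)
      rw [Complex.div_re, ← add_div]
      refine div_nonneg ?_ (Complex.normSq_nonneg _)
      have h2 : ‖f z‖ ^ 2 ≤ 1 := by nlinarith [norm_nonneg (f z)]
      rw [← Complex.normSq_eq_norm_sq, Complex.normSq_apply] at h2
      simp
      nlinarith)
  refine ⟨μ, fun z hz => ?_⟩
  have h1 := (integral_kernel_eq μ hz).symm.trans (hμ z hz)
  have h2 := hne z hz
  rw [eq_div_iff h2] at h1 ⊢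
  linear_combination h1 / 2

theorem eta_eq_of_psi_eq {μ : ProbabilityMeasure Circle} {z w : ℂ} (hw : w ∈ disc)
    (h : psi μ z = w / (1 - w)) : eta μ z = w := by
  have h1 : 1 - w ≠ 0 := by simpa using one_sub_circle_mul_ne_zero 1 hw
  rw [eta, h, one_add_div h1, div_div_div_cancel_right₀ h1]
  simp

/-! ### Holomorphy and positivity of the initial value. -/

section HerglotzTransform

theorem one_sub_norm_le_norm_circle_sub (x : Circle) (z : ℂ) : 1 - ‖z‖ ≤ ‖(x : ℂ) - z‖ := by
  have h := norm_sub_norm_le (x : ℂ) z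
  rwa [Circle.norm_coe] at h

theorem circle_sub_ne_zero (x : Circle) {z : ℂ} (hz : z ∈ disc) : (x : ℂ) - z ≠ 0 := by
  rw [← norm_pos_iff]
  linarith [one_sub_norm_le_norm_circle_sub x z, mem_disc.1 hz]

theorem continuous_herglotz_integrand {z : ℂ} (hz : z ∈ disc) :
    Continuous fun x : Circle => ((x : ℂ) + z) / ((x : ℂ) - z) :=
  Continuous.div (by fun_prop) (by fun_prop) fun x => circle_sub_ne_zero x hz

theorem differentiableOn_herglotz (α : ProbabilityMeasure Circle) :
    DifferentiableOn ℂ (herglotz α) disc := by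
  intro z₀ hz₀
  obtain ⟨r, hr, hr1⟩ := exists_between (mem_disc.1 hz₀)
  have hball : ∀ z ∈ ball (0 : ℂ) r, z ∈ disc := fun z hz =>
    mem_disc.2 ((mem_ball_zero_iff.1 hz).trans hr1)
  have h := hasDerivAt_integral_of_dominated_loc_of_deriv_le (μ := (α : Measure Circle))
    (F := fun z (x : Circle) => ((x : ℂ) + z) / ((x : ℂ) - z))
    (F' := fun z (x : Circle) => 2 * (x : ℂ) / ((x : ℂ) - z) ^ 2) (x₀ := z₀)
    (bound := fun _ => 2 / (1 - r) ^ 2)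
    (isOpen_ball.mem_nhds (mem_ball_zero_iff.2 hr)) ?_
    (integrable_circle α (continuous_herglotz_integrand hz₀)) ?_ ?_ (integrable_const _) ?_
  · exact h.2.differentiableAt.differentiableWithinAt
  · filter_upwards [isOpen_disc.mem_nhds hz₀] with z hz
    exact (continuous_herglotz_integrand hz).aestronglyMeasurable
  · refine Continuous.aestronglyMeasurable (Continuous.div (by fun_prop) (by fun_prop) fun x => ?_)
    exact pow_ne_zero 2 (circle_sub_ne_zero x hz₀)
  · refine .of_forall fun x z hz => ?_
    have h1 := one_sub_norm_le_norm_circle_sub x z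
    have h2 := mem_ball_zero_iff.1 hz
    rw [norm_div, norm_mul, Circle.norm_coe, mul_one, norm_pow, Complex.norm_ofNat]
    have h3 : 0 < 1 - r := by linarith
    gcongr
    linarith
  · refine .of_forall fun x z hz => ?_
    have h1 := circle_sub_ne_zero x (hball z hz)
    convert! ((hasDerivAt_id z).const_add (x : ℂ)).div ((hasDerivAt_id z).const_sub (x : ℂ)) h1
      using 1
    simp only [id]
    ring

theorem mapsTo_herglotz (α : ProbabilityMeasure Circle) : MapsTo (herglotz α) disc RH := by
  intro z hz
  have hz1 := mem_disc.1 hz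
  have hint := integrable_circle α (continuous_herglotz_integrand hz)
  have h1 : (herglotz α z).re =
      ∫ x : Circle, (((x : ℂ) + z) / ((x : ℂ) - z)).re ∂(α : Measure Circle) :=
    (integral_re hint).symm
  -- The Poisson kernel has a positive lower bound independent of `x`, so strict positivity survives
  -- integration.
  have h2 : (1 - ‖z‖) / (1 + ‖z‖) ≤ (herglotz α z).re := by
    rw [h1]
    calc (1 - ‖z‖) / (1 + ‖z‖) = ∫ _ : Circle, (1 - ‖z‖) / (1 + ‖z‖) ∂(α : Measure Circle) := by simp
      _ ≤ _ := by
        refine integral_mono (integrable_const _) hint.re fun x => ?_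
        have := le_re_herglotzRieszKernel (c := 0) (R := 1) (z := (x : ℂ)) (w := z)
          (by rw [mem_sphere_zero_iff_norm, Circle.norm_coe]) (by simpa using hz1)
        simpa using this
  have h3 : 0 < (1 - ‖z‖) / (1 + ‖z‖) := div_pos (by linarith) (by positivity)
  exact h3.trans_le h2

end HerglotzTransform

/-! ### Constancy of solutions along characteristics. -/

/-- The total derivative along a curve, for a uniformly bounded family of holomorphic functions
that is only separately differentiable. -/
theorem hasDerivWithinAt_along_curve {G : ℝ → ℂ → ℂ} {c : ℝ → ℂ} {s : Set ℝ} {t : ℝ} {a c' : ℂ}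
    (hts : t ∈ s) (hG : ∀ r ∈ s, DifferentiableOn ℂ (G r) disc)
    (hb : ∀ r ∈ s, ∀ z ∈ disc, ‖G r z‖ ≤ 1) (hct : c t ∈ disc)
    (hcont : ∀ z ∈ disc, ContinuousWithinAt (fun r => G r z) s t)
    (hd : HasDerivWithinAt (fun r => G r (c t)) a s t) (hc : HasDerivWithinAt c c' s t) :
    HasDerivWithinAt (fun r => G r (c r)) (a + deriv (G t) (c t) * c') s t := by
  set p := c t with hp
  set ρ := 1 - ‖p‖ with hρ
  have hρ0 : 0 < ρ := by have := mem_disc.1 hct; linarith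
  have hsub : ball p ρ ⊆ disc := fun z hz => mem_disc.2 <| by
    have h1 := mem_ball_iff_norm.1 hz
    have h2 := norm_le_norm_add_norm_sub' z p
    linarith
  have hdisc : ball p ρ ∈ 𝓝 p := ball_mem_nhds p hρ0
  -- Two Schwarz estimates: `G r` varies by at most `2`, so its `dslope` is bounded by `2 / ρ` and
  -- varies by at most `4 / ρ`. The resulting Lipschitz bound is uniform in `r`.
  have hlip : ∀ r ∈ s, ∀ z ∈ ball p ρ,
      ‖dslope (G r) p z - deriv (G r) p‖ ≤ 4 / ρ / ρ * ‖z - p‖ := by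
    intro r hr z hz
    have hGr : DifferentiableOn ℂ (G r) (ball p ρ) := (hG r hr).mono hsub
    have hbd : ∀ w ∈ ball p ρ, ‖dslope (G r) p w‖ ≤ 2 / ρ := fun w hw =>
      Complex.norm_dslope_le_div_of_mapsTo_ball hGr (fun v hv => by
        rw [mem_closedBall_iff_norm]
        have := norm_sub_le (G r v) (G r p)
        linarith [hb r hr v (hsub hv), hb r hr p hct]) hw
    have h1 := Complex.dist_le_div_mul_dist_of_mapsTo_ball (f := dslope (G r) p) (R₂ := 4 / ρ)
      ((Complex.differentiableOn_dslope hdisc).2 hGr) (fun v hv => by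
        rw [mem_closedBall_iff_norm]
        have h2 := norm_sub_le (dslope (G r) p v) (dslope (G r) p p)
        have h3 : 4 / ρ = 2 / ρ + 2 / ρ := by ring
        linarith [hbd v hv, hbd p (mem_ball_self hρ0)]) hz
    rwa [dslope_same, dist_eq_norm, dist_eq_norm] at h1
  set K := 4 / ρ / ρ with hK
  have hK0 : 0 < K := by positivity
  -- The moving point `c r` is compared with `p + δ`, fixed as `r` varies, where continuity in `r`
  -- for each fixed point suffices.
  have hlim : Tendsto (fun r => dslope (G r) p (c r)) (𝓝[s] t) (𝓝 (deriv (G t) p)) := by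
    rw [Metric.tendsto_nhds]
    intro ε hε
    set δ := min (ρ / 2) (ε / (8 * K)) with hδ
    have hδ0 : 0 < δ := by positivity
    have hδρ : δ < ρ := (min_le_left _ _).trans_lt (half_lt_self hρ0)
    have hδK : K * δ ≤ ε / 8 := by
      calc K * δ ≤ K * (ε / (8 * K)) := by gcongr; exact min_le_right _ _
        _ = ε / 8 := by field_simp
    have hδn : ‖(p + δ : ℂ) - p‖ = δ := by
      rw [add_sub_cancel_left, Complex.norm_real, Real.norm_of_nonneg hδ0.le]
    have hz : (p + δ : ℂ) ∈ ball p ρ := by rw [mem_ball_iff_norm, hδn]; exact hδρ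
    have hzne : (p + δ : ℂ) ≠ p := by simpa using hδ0.ne'
    have hslope : Tendsto (fun r => dslope (G r) p (p + δ)) (𝓝[s] t)
        (𝓝 (dslope (G t) p (p + δ))) := by
      simp only [dslope_of_ne _ hzne, slope_def_module]
      exact (((hcont _ (hsub hz)).tendsto).sub (hcont p hct).tendsto).const_smul _
    have hcb : ∀ᶠ r in 𝓝[s] t, c r ∈ ball p δ :=
      hc.continuousWithinAt.tendsto.eventually (ball_mem_nhds _ hδ0)
    filter_upwards [(Metric.tendsto_nhds.1 hslope) (ε / 2) (half_pos hε), hcb,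
      self_mem_nhdsWithin] with r h1 h2 hr
    have h3 := mem_ball_iff_norm.1 h2
    have e1 := hlip r hr (c r) (ball_subset_ball hδρ.le h2)
    have e2 := hlip r hr _ hz
    have e3 := hlip t hts _ hz
    rw [hδn] at e2 e3
    have e4 : K * ‖c r - p‖ ≤ K * δ := by gcongr
    rw [dist_eq_norm] at h1 ⊢
    have e5 : dslope (G r) p (c r) - deriv (G t) p =
        (dslope (G r) p (c r) - deriv (G r) p) - (dslope (G r) p (p + δ) - deriv (G r) p) +
        (dslope (G r) p (p + δ) - dslope (G t) p (p + δ)) +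
        (dslope (G t) p (p + δ) - deriv (G t) p) := by ring
    rw [e5]
    refine (norm_add₃_le).trans_lt ?_
    have e6 := norm_sub_le (dslope (G r) p (c r) - deriv (G r) p)
      (dslope (G r) p (p + δ) - deriv (G r) p)
    linarith
  rw [hasDerivWithinAt_iff_tendsto_slope] at hd hc ⊢
  have h1 := hd.add ((hlim.mono_left (nhdsWithin_mono t sdiff_subset)).mul hc)
  refine h1.congr fun r => ?_
  -- Splits the increment into one in time at the fixed point `p` and one in space at time `r`.
  have h2 := sub_smul_dslope (G r) p (c r)
  simp only [slope_def_module, smul_eq_mul] at h2 ⊢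
  rw [← hp]
  simp only [Complex.real_smul]
  linear_combination (((r - t)⁻¹ : ℝ) : ℂ) * h2

/-- The Cayley transform from the right half-plane to the disc. -/
noncomputable def cayley (w : ℂ) : ℂ := (w - 1) / (w + 1)

theorem add_one_ne_zero_of_mem_RH {w : ℂ} (hw : w ∈ RH) : w + 1 ≠ 0 := fun h => by
  have h1 : 0 < w.re := hw
  have h2 := congrArg Complex.re h
  simp at h2
  linarith

theorem cayley_mem_disc {w : ℂ} (hw : w ∈ RH) : cayley w ∈ disc := by
  rw [mem_disc, cayley, norm_div, div_lt_one (norm_pos_iff.2 (add_one_ne_zero_of_mem_RH hw))]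
  refine lt_of_pow_lt_pow_left₀ 2 (norm_nonneg _) ?_
  have h1 : 0 < w.re := hw
  simp only [← Complex.normSq_eq_norm_sq, Complex.normSq_apply]
  simp
  nlinarith

theorem hasDerivAt_cayley {w : ℂ} (hw : w ∈ RH) : HasDerivAt cayley (2 / (w + 1) ^ 2) w := by
  convert! ((hasDerivAt_id w).sub_const 1).div ((hasDerivAt_id w).add_const 1)
    (add_one_ne_zero_of_mem_RH hw) using 1
  simp only [id]
  ring

/-- The inverse of the Cayley transform. -/
noncomputable def cayleyInv (v : ℂ) : ℂ := (1 + v) / (1 - v)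

theorem cayleyInv_cayley {w : ℂ} (hw : w ∈ RH) : cayleyInv (cayley w) = w := by
  have h := add_one_ne_zero_of_mem_RH hw
  rw [cayleyInv, cayley, one_add_div h, one_sub_div h, div_div_div_cancel_right₀ h]
  ring

theorem one_sub_ne_zero_of_mem_disc {v : ℂ} (hv : v ∈ disc) : 1 - v ≠ 0 := by
  simpa using one_sub_circle_mul_ne_zero 1 hv

theorem cayleyInv_mem_RH {v : ℂ} (hv : v ∈ disc) : cayleyInv v ∈ RH := by
  have h1 := mem_disc.1 hv
  change 0 < (cayleyInv v).re
  rw [cayleyInv, Complex.div_re, ← add_div]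
  refine div_pos ?_ (Complex.normSq_pos.2 (one_sub_ne_zero_of_mem_disc hv))
  have h2 : ‖v‖ ^ 2 < 1 := by nlinarith [norm_nonneg v]
  rw [← Complex.normSq_eq_norm_sq, Complex.normSq_apply] at h2
  simp
  nlinarith

theorem differentiableOn_cayleyInv : DifferentiableOn ℂ cayleyInv disc :=
  DifferentiableOn.div (by fun_prop) (by fun_prop) fun _ hv => one_sub_ne_zero_of_mem_disc hv

/-- A function holomorphic on the disc is Lipschitz on compact subsets. -/
theorem exists_lipschitz_on_compact {f : ℂ → ℂ} (hf : DifferentiableOn ℂ f disc) {k : Set ℂ}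
    (hk : IsCompact k) (hkd : k ⊆ disc) :
    ∃ C : ℝ, ∀ v ∈ k, ∀ w ∈ k, ‖f v - f w‖ ≤ C * ‖v - w‖ := by
  rcases k.eq_empty_or_nonempty with rfl | hne
  · exact ⟨0, by simp⟩
  obtain ⟨v₀, hv₀, hmax⟩ := hk.exists_isMaxOn hne continuous_norm.continuousOn
  have hsub : closedBall (0 : ℂ) ‖v₀‖ ⊆ disc := closedBall_subset_ball (mem_disc.1 (hkd hv₀))
  obtain ⟨C, hC⟩ := (isCompact_closedBall (0 : ℂ) ‖v₀‖).exists_bound_of_continuousOn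
    ((hf.deriv isOpen_disc).continuousOn.mono hsub)
  refine ⟨C, fun v hv w hw => ?_⟩
  exact (convex_closedBall (0 : ℂ) ‖v₀‖).norm_image_sub_le_of_norm_deriv_le
    (fun z hz => hf.differentiableAt (isOpen_disc.mem_nhds (hsub hz))) hC
    (mem_closedBall_zero_iff.2 (hmax hw)) (mem_closedBall_zero_iff.2 (hmax hv))

/-- The curve uses the constant `S h`, not `S (N t (c t))`, so constancy is not presupposed. The
derivative of `m = cayley (N t (c t))` carries the factor `S h - S (N t (c t))`, and Gronwall forces
`m = cayley h`. The Cayley transform supplies the boundedness needed for derivative estimates. -/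
theorem IsSolution.eq_along_characteristic {S : ℂ → ℂ} (hS : DifferentiableOn ℂ S RH)
    {α : ProbabilityMeasure Circle} {N : ℝ → ℂ → ℂ} (hN : IsSolution S α N) {h w : ℂ}
    (hw : w ∈ disc) (hh : herglotz α w = h) {c : ℝ → ℂ} (hc0 : c 0 = w)
    (hc : ∀ t, HasDerivAt c (c t * S h) t) {T : ℝ} (hT : 0 ≤ T) {R : ℝ} (hR : R < 1)
    (hcR : ∀ t ∈ Icc 0 T, ‖c t‖ ≤ R) : N T (c T) = h := by
  have hhRH : h ∈ RH := hh ▸ mapsTo_herglotz α hw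
  have hcd : ∀ t ∈ Icc 0 T, c t ∈ disc := fun t ht => mem_disc.2 ((hcR t ht).trans_lt hR)
  set G : ℝ → ℂ → ℂ := fun t z => cayley (N t z) with hG
  have hNd : ∀ t, 0 ≤ t → ∀ z ∈ disc, HasDerivAt (N t) (deriv (N t) z) z := fun t ht z hz =>
    ((hN.holo t ht).differentiableAt (isOpen_disc.mem_nhds hz)).hasDerivAt
  have hGd : ∀ t, 0 ≤ t → ∀ z ∈ disc,
      HasDerivAt (G t) (2 / (N t z + 1) ^ 2 * deriv (N t) z) z := fun t ht z hz =>
    (hasDerivAt_cayley (hN.mapsTo t ht hz)).comp z (hNd t ht z hz)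
  have hGdiff : ∀ t ∈ Ici (0 : ℝ), DifferentiableOn ℂ (G t) disc := fun t ht z hz =>
    (hGd t ht z hz).differentiableAt.differentiableWithinAt
  have hGb : ∀ t ∈ Ici (0 : ℝ), ∀ z ∈ disc, ‖G t z‖ ≤ 1 := fun t ht z hz =>
    (mem_disc.1 (cayley_mem_disc (hN.mapsTo t ht hz))).le
  have hGt : ∀ t, 0 ≤ t → ∀ z ∈ disc, HasDerivWithinAt (fun s => G s z)
      (2 / (N t z + 1) ^ 2 * (-z * S (N t z) * deriv (N t) z)) (Ici 0) t := fun t ht z hz =>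
    HasDerivAt.comp_hasDerivWithinAt (h := fun s => N s z) t
      (hasDerivAt_cayley (hN.mapsTo t ht hz)) (hN.pde t ht z hz)
  set m : ℝ → ℂ := fun t => G t (c t) with hm
  have hmd : ∀ t ∈ Icc 0 T, HasDerivWithinAt m
      (deriv (G t) (c t) * c t * (S h - S (N t (c t)))) (Ici 0) t := by
    intro t ht
    have h1 := hasDerivWithinAt_along_curve (s := Ici 0) ht.1 hGdiff hGb (hcd t ht)
      (fun z hz => (hGt t ht.1 z hz).continuousWithinAt) (hGt t ht.1 _ (hcd t ht))
      (hc t).hasDerivWithinAt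
    refine h1.congr_deriv ?_
    rw [(hGd t ht.1 _ (hcd t ht)).deriv]
    ring
  have hmc : ContinuousOn m (Icc 0 T) := fun t ht =>
    (hmd t ht).continuousWithinAt.mono fun s hs => hs.1
  have hmdisc : ∀ t ∈ Icc 0 T, m t ∈ disc := fun t ht =>
    cayley_mem_disc (hN.mapsTo t ht.1 (hcd t ht))
  -- `S ∘ cayleyInv` need only be locally Lipschitz, because the path of `m` is compact in the disc.
  set k : Set ℂ := insert (cayley h) (m '' Icc 0 T) with hk
  obtain ⟨C, hC⟩ := exists_lipschitz_on_compact (f := S ∘ cayleyInv) (k := k)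
    (hS.comp differentiableOn_cayleyInv fun v hv => cayleyInv_mem_RH hv)
    ((isCompact_Icc.image_of_continuousOn hmc).insert _) (by
      rintro v (rfl | ⟨t, ht, rfl⟩)
      · exact cayley_mem_disc hhRH
      · exact hmdisc t ht)
  have hderiv : ∀ t ∈ Icc 0 T, ‖deriv (G t) (c t)‖ ≤ 2 / (1 - R) := by
    intro t ht
    have hsub : ball (c t) (1 - R) ⊆ disc := fun z hz => mem_disc.2 <| by
      have h1 := mem_ball_iff_norm.1 hz
      have h2 := norm_le_norm_add_norm_sub' z (c t)
      linarith [hcR t ht]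
    refine Complex.norm_deriv_le_div_of_mapsTo_ball ((hGdiff t ht.1).mono hsub) (fun v hv => ?_)
      (by linarith)
    rw [mem_closedBall_iff_norm]
    have := norm_sub_le (G t v) (G t (c t))
    linarith [hGb t ht.1 v (hsub hv), hGb t ht.1 _ (hcd t ht)]
  have hzero := eq_zero_of_abs_deriv_le_mul_abs_self_of_eq_zero_right (a := 0) (b := T)
    (f := fun t => m t - cayley h) (K := 2 / (1 - R) * C) (hmc.sub continuousOn_const)
    (fun t ht => ((hmd t ⟨ht.1, ht.2.le⟩).mono (Ici_subset_Ici.2 ht.1)).sub_const _)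
    (by simp [hm, hG, hc0, hN.init w hw, hh]) (fun t ht => ?_) T ⟨hT, le_rfl⟩
  · have h1 : cayley (N T (c T)) = cayley h := sub_eq_zero.1 hzero
    rw [← cayleyInv_cayley hhRH, ← h1,
      cayleyInv_cayley (hN.mapsTo T hT (hcd T ⟨hT, le_rfl⟩))]
  · have ht' : t ∈ Icc 0 T := ⟨ht.1, ht.2.le⟩
    have h1 := hC (cayley h) (mem_insert _ _) (m t) (mem_insert_of_mem _ ⟨t, ht', rfl⟩)
    simp only [Function.comp_apply, cayleyInv_cayley hhRH, hm, hG,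
      cayleyInv_cayley (hN.mapsTo t ht.1 (hcd t ht'))] at h1
    rw [norm_sub_rev (cayley h)] at h1
    rw [norm_mul, norm_mul, mul_assoc (2 / (1 - R))]
    have h2 : ‖c t‖ ≤ 1 := (mem_disc.1 (hcd t ht')).le
    have h3 : 0 < 1 - R := by linarith
    calc _ ≤ 2 / (1 - R) * 1 * ‖S h - S (N t (c t))‖ := by
          gcongr
          exact hderiv t ht'
      _ ≤ _ := by
          rw [mul_one]
          gcongr

/-! ### `Σ`-transforms and the convolution semigroup. -/

theorem IsLocalInverse.eventuallyEq {f g₁ g₂ : ℂ → ℂ} (h₁ : IsLocalInverse f g₁)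
    (h₂ : IsLocalInverse f g₂) : g₁ =ᶠ[𝓝 0] g₂ := by
  have ht : Tendsto g₁ (𝓝 0) (𝓝 0) := by
    have := h₁.1.continuousAt.tendsto
    rwa [h₁.2.1] at this
  filter_upwards [h₁.2.2, ht.eventually h₂.2.2] with z hz hz'
  rw [← hz'.2, hz.1]

theorem etaInv_eventuallyEq {μ : ProbabilityMeasure Circle} {g : ℂ → ℂ}
    (hg : IsLocalInverse (eta μ) g) : etaInv μ =ᶠ[𝓝 0] g := by
  have h : ∃ g, IsLocalInverse (eta μ) g := ⟨g, hg⟩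
  rw [etaInv, dif_pos h]
  exact (Classical.choose_spec h).eventuallyEq hg

theorem dslope_congr_of_eventuallyEq {f g : ℂ → ℂ} {a : ℂ} (h : f =ᶠ[𝓝 a] g) :
    dslope f a =ᶠ[𝓝 a] dslope g a := by
  filter_upwards [h] with z hz
  rcases eq_or_ne z a with rfl | hne
  · rw [dslope_same, dslope_same, h.deriv_eq]
  · rw [dslope_of_ne _ hne, dslope_of_ne _ hne, slope_def_module, slope_def_module, hz,
      h.self_of_nhds]

section Semigroup

variable {u : ℂ → ℂ}

theorem zero_mem_disc : (0 : ℂ) ∈ disc := mem_disc.2 (by simp)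

theorem dslope_charMap (hu : DifferentiableOn ℂ u disc) (t : ℂ) :
    dslope (charMap u t) 0 = fun z => Complex.exp (t * u z) := by
  ext z
  rcases eq_or_ne z 0 with rfl | hne
  · rw [dslope_same, (hasDerivAt_charMap hu t zero_mem_disc).deriv]
    simp
  · rw [dslope_of_ne _ hne, slope_def_module]
    simp [charMap, hne]

theorem flow_zero_right (hu : DifferentiableOn ℂ u disc) (hre : ∀ z ∈ disc, 0 ≤ (u z).re)
    {t : ℝ} (ht : 0 ≤ t) : flow u t 0 = 0 :=
  flow_eq_of_charMap_eq hu hre ht zero_mem_disc zero_mem_disc (by simp [charMap])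

theorem flow_zero_left (hu : DifferentiableOn ℂ u disc) (hre : ∀ z ∈ disc, 0 ≤ (u z).re)
    {z : ℂ} (hz : z ∈ disc) : flow u 0 z = z :=
  flow_eq_of_charMap_eq hu hre le_rfl hz hz (by simp [charMap])

variable {μ : ProbabilityMeasure Circle} {t : ℝ}

theorem isLocalInverse_charMap (hu : DifferentiableOn ℂ u disc)
    (hre : ∀ z ∈ disc, 0 ≤ (u z).re) (ht : 0 ≤ t) (hμ : ∀ z ∈ disc, eta μ z = flow u t z) :
    IsLocalInverse (eta μ) (charMap u t) := by
  have hd : ∀ᶠ z in 𝓝 (0 : ℂ), z ∈ disc := isOpen_disc.mem_nhds zero_mem_disc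
  have h0 : charMap u t 0 = 0 := by simp [charMap]
  have han : AnalyticAt ℂ (charMap u t) 0 :=
    DifferentiableOn.analyticAt (s := disc) (fun v hv =>
      (hasDerivAt_charMap hu t hv).differentiableAt.differentiableWithinAt) hd
  refine ⟨han, h0, ?_⟩
  have hc : Tendsto (charMap u t) (𝓝 0) (𝓝 0) := by
    have := han.continuousAt.tendsto
    rwa [h0] at this
  filter_upwards [hd, hc.eventually hd] with z hz hz'
  constructor
  · rw [hμ _ hz']
    exact flow_eq_of_charMap_eq hu hre ht hz' hz rfl
  · rw [hμ _ hz]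
    exact (flow_spec hu hre ht hz).2

/-- `charMap u t` composed with the flow is the identity near `0`, so the chain rule excludes a zero
derivative. -/
theorem mem_PTimes_of_eta_eq_flow (hu : DifferentiableOn ℂ u disc)
    (hre : ∀ z ∈ disc, 0 ≤ (u z).re) (ht : 0 ≤ t) (hμ : ∀ z ∈ disc, eta μ z = flow u t z) :
    μ ∈ PTimes := by
  have heq : eta μ =ᶠ[𝓝 0] flow u t := by
    filter_upwards [isOpen_disc.mem_nhds zero_mem_disc] with z hz using hμ z hz
  change deriv (eta μ) 0 ≠ 0
  rw [heq.deriv_eq]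
  intro h0
  have h1 := (flow_derivs hu hre ht zero_mem_disc).1.hasDerivAt
  have h2 := hasDerivAt_charMap hu t (flow_spec hu hre ht zero_mem_disc).1
  have h3 := h2.comp (0 : ℂ) h1
  rw [h0, mul_zero] at h3
  refine zero_ne_one (h3.unique ((hasDerivAt_id (0 : ℂ)).congr_of_eventuallyEq ?_))
  filter_upwards [isOpen_disc.mem_nhds zero_mem_disc] with z hz using (flow_spec hu hre ht hz).2

theorem sigmaTransform_eventuallyEq (hu : DifferentiableOn ℂ u disc)
    (hre : ∀ z ∈ disc, 0 ≤ (u z).re) (ht : 0 ≤ t) (hμ : ∀ z ∈ disc, eta μ z = flow u t z) :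
    sigmaTransform μ =ᶠ[𝓝 0] fun z => Complex.exp (t * u z) := by
  rw [← dslope_charMap hu]
  exact dslope_congr_of_eventuallyEq
    (etaInv_eventuallyEq (isLocalInverse_charMap hu hre ht hμ))

/-- The flow of `u` consists of the `η`-transforms of a free multiplicative convolution
semigroup. -/
theorem exists_freeMulSemigroup (hu : DifferentiableOn ℂ u disc)
    (hre : ∀ z ∈ disc, 0 ≤ (u z).re) :
    ∃ ν : NNReal → ProbabilityMeasure Circle, IsFreeMulSemigroup ν ∧
      ∀ t : NNReal, ∀ z ∈ disc, eta (ν t) z = flow u t z := by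
  have hmem : ∀ t : NNReal, ∀ z ∈ disc, flow u t z ∈ disc := fun t z hz =>
    (flow_spec hu hre t.2 hz).1
  -- Time `0` is treated apart: the measure itself must be `δ_1`, and choosing it directly avoids
  -- proving that `ψ` determines a measure.
  have hex : ∀ t : NNReal, ∃ μ : ProbabilityMeasure Circle,
      (t = 0 → (μ : Measure Circle) = Measure.dirac 1) ∧
        ∀ z ∈ disc, psi μ z = flow u t z / (1 - flow u t z) := by
    intro t
    rcases eq_or_ne t 0 with rfl | ht
    · refine ⟨⟨Measure.dirac 1, inferInstance⟩, fun _ => rfl, fun z hz => ?_⟩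
      rw [NNReal.coe_zero, flow_zero_left hu hre hz]
      exact psi_dirac_one rfl z
    · obtain ⟨μ, hμ⟩ := exists_psi_eq (f := flow u t)
        (fun z hz => (flow_derivs hu hre t.2 hz).1.differentiableWithinAt) (hmem t)
        (flow_zero_right hu hre t.2)
      exact ⟨μ, fun h => absurd h ht, hμ⟩
  choose ν hν0 hν using hex
  have heta : ∀ t : NNReal, ∀ z ∈ disc, eta (ν t) z = flow u t z := fun t z hz =>
    eta_eq_of_psi_eq (hmem t z hz) (hν t z hz)
  refine ⟨ν, ⟨hν0 0 rfl, fun s t => ?_, ?_⟩, heta⟩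
  · have hP : ∀ t, ν t ∈ PTimes := fun t => mem_PTimes_of_eta_eq_flow hu hre t.2 (heta t)
    have hσ : ∀ t : NNReal, sigmaTransform (ν t) =ᶠ[𝓝 0] fun z => Complex.exp ((t : ℝ) * u z) :=
      fun t => sigmaTransform_eventuallyEq hu hre t.2 (heta t)
    refine ⟨hP _, hP _, hP _, ?_⟩
    filter_upwards [hσ t, hσ s, hσ (t + s)] with z h1 h2 h3
    rw [h1, h2, h3, ← Complex.exp_add]
    congr 1
    push_cast
    ring
  · refine continuous_of_continuous_psi fun z hz => ?_
    have hc : Continuous fun t : NNReal => flow u t z :=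
      (continuousOn_flow hu hre).comp_continuous (f := fun t : NNReal => ((t : ℝ), z))
        (by fun_prop) fun t => ⟨t.2, hz⟩
    simp only [hν _ z hz]
    exact hc.div (continuous_const.sub hc) fun t => one_sub_ne_zero_of_mem_disc (hmem t z hz)

end Semigroup

/-! ### Existence and uniqueness for the equation. -/

section Burgers

variable {S : ℂ → ℂ} {α : ProbabilityMeasure Circle}

theorem isSolution_herglotz_flow (hS : DifferentiableOn ℂ S RH) (hSmaps : MapsTo S RH RH) :
    IsSolution S α fun t z => herglotz α (flow (S ∘ herglotz α) t z) := by
  have hu : DifferentiableOn ℂ (S ∘ herglotz α) disc :=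
    hS.comp (differentiableOn_herglotz α) (mapsTo_herglotz α)
  have hre : ∀ z ∈ disc, 0 ≤ ((S ∘ herglotz α) z).re := fun z hz =>
    (hSmaps (mapsTo_herglotz α hz)).le
  have hH : ∀ z ∈ disc, HasDerivAt (herglotz α) (deriv (herglotz α) z) z := fun z hz =>
    ((differentiableOn_herglotz α).differentiableAt (isOpen_disc.mem_nhds hz)).hasDerivAt
  have hd : ∀ t, 0 ≤ t → ∀ z ∈ disc,
      HasDerivAt (fun z => herglotz α (flow (S ∘ herglotz α) t z))
        (deriv (herglotz α) (flow (S ∘ herglotz α) t z) * deriv (flow (S ∘ herglotz α) t) z) z :=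
    fun t ht z hz => (hH _ (flow_spec hu hre ht hz).1).comp z
      (flow_derivs hu hre ht hz).1.hasDerivAt
  refine ⟨fun t ht z hz => (hd t ht z hz).differentiableAt.differentiableWithinAt,
    fun t ht z hz => mapsTo_herglotz α (flow_spec hu hre ht hz).1, fun t ht z hz => ?_,
    fun z hz => by rw [flow_zero_left hu hre hz]⟩
  have h1 := HasDerivAt.comp_hasDerivWithinAt (h := fun s : ℝ => flow (S ∘ herglotz α) s z) t
    (hH _ (flow_spec hu hre ht hz).1) (flow_derivs hu hre ht hz).2
  refine h1.congr_deriv ?_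
  rw [(hd t ht z hz).deriv, Function.comp_apply]
  ring

theorem IsSolution.eq_herglotz_flow (hS : DifferentiableOn ℂ S RH) (hSmaps : MapsTo S RH RH)
    {N : ℝ → ℂ → ℂ} (hN : IsSolution S α N) {T : ℝ} (hT : 0 ≤ T) {z : ℂ} (hz : z ∈ disc) :
    N T z = herglotz α (flow (S ∘ herglotz α) T z) := by
  have hu : DifferentiableOn ℂ (S ∘ herglotz α) disc :=
    hS.comp (differentiableOn_herglotz α) (mapsTo_herglotz α)
  have hre : ∀ z ∈ disc, 0 ≤ ((S ∘ herglotz α) z).re := fun z hz =>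
    (hSmaps (mapsTo_herglotz α hz)).le
  obtain ⟨hw, hwz⟩ := flow_spec hu hre hT hz
  set w := flow (S ∘ herglotz α) T z
  -- Written backwards from its endpoint `z`, the characteristic visibly stays in the ball of radius
  -- `‖z‖` on `[0, T]`.
  have hcz : ∀ t : ℝ, charMap (S ∘ herglotz α) t w =
      z * Complex.exp (-(((T - t : ℝ) : ℂ) * S (herglotz α w))) := fun t => by
    rw [← hwz, charMap, charMap, mul_assoc, ← Complex.exp_add]
    congr 2
    simp only [Function.comp_apply]
    push_cast
    ring
  have key := hN.eq_along_characteristic hS (h := herglotz α w) hw rfl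
    (c := fun t => charMap (S ∘ herglotz α) t w) (by simp [charMap]) (fun t => ?_) hT
    (mem_disc.1 hz) (fun t ht => ?_)
  · simpa only [hwz] using key
  · have h1 : HasDerivAt (fun t : ℂ => charMap (S ∘ herglotz α) t w)
        (charMap (S ∘ herglotz α) t w * S (herglotz α w)) (t : ℂ) := by
      convert! (((hasDerivAt_id (t : ℂ)).mul_const (S (herglotz α w))).cexp).const_mul w using 1
      simp only [charMap, id, Function.comp_apply]
      ring
    exact h1.comp_ofReal
  · rw [hcz, norm_mul]
    exact mul_le_of_le_one_right (norm_nonneg _)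
      (norm_exp_neg_le_one (sub_nonneg.2 ht.2) (hre w hw))

end Burgers

end BurgersLoewner

open BurgersLoewner in
theorem theorem4p3 (S : ℂ → ℂ) (hS : DifferentiableOn ℂ S RH) (hSmaps : Set.MapsTo S RH RH)
    (α : MeasureTheory.ProbabilityMeasure Circle) :
    ∃ M : ℝ → ℂ → ℂ, IsSolution S α M ∧
      (∀ N : ℝ → ℂ → ℂ, IsSolution S α N → ∀ t : ℝ, 0 ≤ t → ∀ z ∈ disc, N t z = M t z) ∧
      ∃ ν : NNReal → MeasureTheory.ProbabilityMeasure Circle, IsFreeMulSemigroup ν ∧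
        ∀ t : NNReal, ∀ z ∈ disc, eta (ν t) z ∈ disc ∧ M t z = M 0 (eta (ν t) z) := by
  have hu : DifferentiableOn ℂ (S ∘ herglotz α) disc :=
    hS.comp (differentiableOn_herglotz α) (mapsTo_herglotz α)
  have hre : ∀ z ∈ disc, 0 ≤ ((S ∘ herglotz α) z).re := fun z hz =>
    (hSmaps (mapsTo_herglotz α hz)).le
  obtain ⟨ν, hν, heta⟩ := exists_freeMulSemigroup hu hre
  refine ⟨_, isSolution_herglotz_flow hS hSmaps,
    fun N hN t ht z hz => hN.eq_herglotz_flow hS hSmaps ht hz, ν, hν, fun t z hz => ?_⟩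
  have hmem := (flow_spec hu hre t.2 hz).1
  rw [heta t z hz]
  exact ⟨hmem, congrArg (herglotz α) (flow_zero_left hu hre hmem).symm⟩
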